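/- Let $n\ge 0$. Let $\mathcal J(\mathbb R^{2n+2})=\{A\in gl(2n+2,\mathbb R)\mid A^2=-I\}$ be the space of all complex structures on $\mathbb R^{2n+2}$, with the almost complex structure $\tilde J X=AX$ for $X\in T_A\mathcal J(\mathbb R^{2n+2})$ and the Riemannian metric $$ds^2(X,Y)=\tfrac12\langle X,Y\rangle_A+\tfrac12\langle \tilde JX,\tilde JY\rangle_A,\qquad \langle X,Y\rangle_A=\tfrac12\operatorname{tr}(XY^t)+\tfrac12\operatorname{tr}\big(AXA^{-1}(AYA^{-1})^t\big).$$ Let $\widetilde{\mathcal J}(\mathbb R^{2n+2})=\mathcal J(\mathbb R^{2n+2})\cap O(2n+2)$. Put $e_{-1}=(1,0,\dots,0)^t$, let $S^{2n}$ be the unit sphere of $e_{-1}^\perp\subset\mathbb R^{2n+2}$, and let $\widetilde{\mathcal J}(S^{2n})$ be the orthogonal twistor space of $S^{2n}$: the set of all $A\in\mathcal J(\mathbb R^{2n+2})$ such that $e_0=Ae_{-1}$ lies in $S^{2n}$ and $A$ maps $T_{e_0}S^{2n}=\{e_{-1},e_0\}^\perp$ to itself, orthogonally. **Theorem.** (1)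 $\widetilde{\mathcal J}(S^{2n})=\widetilde{\mathcal J}(\mathbb R^{2n+2})$, and $g\mapsto gJ_0g^{-1}$ induces a homeomorphism of $O(2n+2)/U(n+1)$ onto this space, where $J_0$ is the standard complex structure of $\mathbb R^{2n+2}$ and $U(n+1)=\{g\in O(2n+2)\mid gJ_0=J_0g\}$. (2) $\widetilde{\mathcal J}(S^{2n})$ is a Kähler submanifold of $\mathcal J(\mathbb R^{2n+2})$. That is, $\mathcal J(\mathbb R^{2n+2})$ is an embedded submanifold of $gl(2n+2,\mathbb R)$ on which $\tilde J$ is an integrable complex structure and $ds^2$ is a Riemannian metric with $ds^2(\tilde JX,\tilde JY)=ds^2(X,Y)$; $\widetilde{\mathcal J}(S^{2n})$ is an embedded submanifold contained in it, with $\tilde J(T_A\widetilde{\mathcal J}(S^{2n}))=T_A\widetilde{\mathcal J}(S^{2n})$ for every $A\in\widetilde{\mathcal J}(S^{2n})$; and with the induced complex structure (which is integrable) and the induced metric, $\widetilde{\mathcal J}(S^{2n})$ is a Kähler manifold, i.e. its fundamental form $\omega(X,Y)=ds^2(\tilde JX,Y)$ is closed. -/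

import Mathlib

open scoped ContDiff Matrix

/-!
# Kähler submanifolds of a real normed space and twistor spaces

All manifolds that occur are embedded submanifolds of a real vector space `E` (here a space of
real square matrices), the almost complex structure is a family `J p : E → E` of linear maps and
the metric a family `g p` of bilinear forms; only their restrictions to the tangent spaces of the
submanifold matter.
-/

section Submanifolds

variable {E : Type*} [NormedAddCommGroup E] [NormedSpace ℝ E]

/-- The model space `ℂ^d`; it is also used as the real vector space `ℝ^(2d)`. -/
abbrev ComplexModel (d : ℕ) : Type := EuclideanSpace ℂ (Fin d)

/-- The tangent space of `M ⊆ E` at `p`: the velocities at `p` of the smooth curves of `E` that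
run in `M`. -/
def tangentVectors (M : Set E) (p : E) : Set E :=
  {v | ∃ γ : ℝ → E, ContDiffAt ℝ ∞ γ 0 ∧ γ 0 = p ∧ (∀ᶠ t in nhds (0 : ℝ), γ t ∈ M) ∧
    HasDerivAt γ v 0}

/-- `ψ : V → M` is a smooth local parametrization of the (embedded) submanifold `M ⊆ E`, of real
dimension `2 d`: `V` is open, `ψ` is smooth on `V`, it maps `V` onto a relatively open part `M ∩ U`
of `M`, and it has an inverse `χ` (a coordinate map of `M`) that is the restriction of a smooth map
defined on the open set `U` of `E`. In particular `ψ` is an immersion and a homeomorphism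
from `V` onto `M ∩ U`. -/
structure IsLocalParametrization {d : ℕ} (M : Set E) (V : Set (ComplexModel d))
    (ψ : ComplexModel d → E) : Prop where
  isOpen : IsOpen V
  smooth : ContDiffOn ℝ ∞ ψ V
  exists_coordinates : ∃ (U : Set E) (χ : E → ComplexModel d), IsOpen U ∧ ContDiffOn ℝ ∞ χ U ∧
    ψ '' V = M ∩ U ∧ ∀ z ∈ V, χ (ψ z) = z

/-- A local parametrization whose differential intertwines multiplication by `i` on `ℂ^d` with the
almost complex structure `J`; its inverse is a system of local complex coordinates of `(M, J)`. -/
structure IsHolomorphicParametrization {d : ℕ} (M : Set E) (J : E → E →ₗ[ℝ] E)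
    (V : Set (ComplexModel d)) (ψ : ComplexModel d → E) : Prop
    extends IsLocalParametrization M V ψ where
  fderiv_I_smul : ∀ z ∈ V, ∀ u : ComplexModel d,
    fderiv ℝ ψ z (Complex.I • u) = J (ψ z) (fderiv ℝ ψ z u)

/-- `M ⊆ E` is an embedded submanifold and `J` restricts to an integrable almost complex structure
on it: `J` preserves the tangent spaces, `J² = -1` on them, and `M` is covered by
local complex coordinates. So `(M, J)` is a complex manifold of complex dimension `d`. -/
structure IsComplexManifold (d : ℕ) (M : Set E) (J : E → E →ₗ[ℝ] E) : Prop where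
  map_tangent : ∀ p ∈ M, ∀ v ∈ tangentVectors M p, J p v ∈ tangentVectors M p
  sq_eq_neg : ∀ p ∈ M, ∀ v ∈ tangentVectors M p, J p (J p v) = -v
  exists_parametrization : ∀ p ∈ M, ∃ (V : Set (ComplexModel d)) (ψ : ComplexModel d → E),
    IsHolomorphicParametrization M J V ψ ∧ p ∈ ψ '' V

/-- `(M, J)` is a complex manifold of dimension `d`, and `g` restricts to a (smooth) Riemannian
metric on `M` for which `J` is orthogonal. -/
structure IsHermitianManifold (d : ℕ) (M : Set E) (J : E → E →ₗ[ℝ] E)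
    (g : E → LinearMap.BilinForm ℝ E) : Prop extends IsComplexManifold d M J where
  metric_symm : ∀ p ∈ M, ∀ v ∈ tangentVectors M p, ∀ w ∈ tangentVectors M p, g p v w = g p w v
  metric_pos : ∀ p ∈ M, ∀ v ∈ tangentVectors M p, v ≠ 0 → 0 < g p v v
  metric_smooth : ∀ (V : Set (ComplexModel d)) (ψ : ComplexModel d → E),
    IsLocalParametrization M V ψ → ∀ u w : ComplexModel d,
      ContDiffOn ℝ ∞ (fun z => g (ψ z) (fderiv ℝ ψ z u) (fderiv ℝ ψ z w)) V
  metric_J : ∀ p ∈ M, ∀ v ∈ tangentVectors M p, ∀ w ∈ tangentVectors M p,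
    g p (J p v) (J p w) = g p v w

/-- The Hermitian manifold `(M, J, g)` is Kähler: its fundamental form `ω(v, w) = g(J v, w)`
is closed. That is, in every local parametrization `ψ` of `M`, the pulled-back form `ψ^* ω`
is a smooth 2-form `η` with `d η = 0`. -/
structure IsKahlerManifold (d : ℕ) (M : Set E) (J : E → E →ₗ[ℝ] E)
    (g : E → LinearMap.BilinForm ℝ E) : Prop extends IsHermitianManifold d M J g where
  closed : ∀ (V : Set (ComplexModel d)) (ψ : ComplexModel d → E), IsLocalParametrization M V ψ →
    ∃ η : ComplexModel d → (ComplexModel d) [⋀^Fin 2]→L[ℝ] ℝ,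
      ContDiffOn ℝ ∞ η V ∧
      (∀ z ∈ V, ∀ u w : ComplexModel d,
        η z ![u, w] = g (ψ z) (J (ψ z) (fderiv ℝ ψ z u)) (fderiv ℝ ψ z w)) ∧
      ∀ z ∈ V, extDeriv η z = 0

/-- `N` is a Kähler submanifold of the complex manifold `M` with Hermitian metric `g`: it is a
submanifold contained in `M`, its tangent spaces are invariant under the complex structure `J` of
`M`, and with the complex structure and the metric induced from `M` it is a Kähler manifold. -/
def IsKahlerSubmanifold (N M : Set E) (J : E → E →ₗ[ℝ] E)
    (g : E → LinearMap.BilinForm ℝ E) : Prop :=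
  (∃ d, IsHermitianManifold d M J g) ∧ N ⊆ M ∧
    (∀ p ∈ N, J p '' tangentVectors N p = tangentVectors N p) ∧
    ∃ d, IsKahlerManifold d N J g

end Submanifolds

-- The norm on matrices serves to speak of smooth maps; any other norm would do.
attribute [local instance] Matrix.frobeniusNormedRing Matrix.frobeniusNormedAlgebra

section TwistorSpaces

/-- Real square matrices of size `2 m`, the endomorphisms of `ℝ^(2m)`. -/
abbrev RMat (m : ℕ) : Type := Matrix (Fin (2 * m)) (Fin (2 * m)) ℝ

/-- The standard complex structure of `ℝ^(2m)`: with the basis vectors numbered from `0`, it maps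
`e_(2i)` to `e_(2i+1)` and `e_(2i+1)` to `-e_(2i)`. -/
def stdComplexStructure (m : ℕ) : RMat m :=
  Matrix.of fun i j =>
    if j.val % 2 = 0 ∧ i.val = j.val + 1 then 1
    else if i.val % 2 = 0 ∧ j.val = i.val + 1 then -1
    else 0

/-- The twistor space `𝒥(ℝ^(2m))` of all complex structures on `ℝ^(2m)`. -/
def twistorSpace (m : ℕ) : Set (RMat m) := {A | A * A = -1}

/-- The orthogonal twistor space of `ℝ^(2m)`, all orthogonal complex structures on `ℝ^(2m)`. -/
def orthTwistorSpace (m : ℕ) : Set (RMat m) :=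
  {A | A ∈ twistorSpace m ∧ A ∈ Matrix.orthogonalGroup (Fin (2 * m)) ℝ}

/-- `U(m)`, the stabilizer of the standard complex structure in `O(2m)`. -/
def unitaryStabilizer (m : ℕ) : Subgroup (Matrix.orthogonalGroup (Fin (2 * m)) ℝ) where
  carrier := {h | (h : RMat m) * stdComplexStructure m = stdComplexStructure m * (h : RMat m)}
  mul_mem' := by
    intro a b ha hb
    simp only [Set.mem_ofPred_eq] at ha hb ⊢
    rw [Submonoid.coe_mul, mul_assoc, hb, ← mul_assoc, ha, mul_assoc]
  one_mem' := by simp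
  inv_mem' := by
    intro a ha
    simp only [Set.mem_ofPred_eq] at ha ⊢
    have h1 : ((a⁻¹ : Matrix.orthogonalGroup (Fin (2 * m)) ℝ) : RMat m) * (a : RMat m) = 1 := by
      rw [← Submonoid.coe_mul]; simp
    have h2 : (a : RMat m) * ((a⁻¹ : Matrix.orthogonalGroup (Fin (2 * m)) ℝ) : RMat m) = 1 := by
      rw [← Submonoid.coe_mul]; simp
    calc _ = (a⁻¹ : Matrix.orthogonalGroup (Fin (2 * m)) ℝ).val * stdComplexStructure m *
            ((a : RMat m) * (a⁻¹ : Matrix.orthogonalGroup (Fin (2 * m)) ℝ).val) := by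
          rw [h2, mul_one]
      _ = (a⁻¹ : Matrix.orthogonalGroup (Fin (2 * m)) ℝ).val *
            (stdComplexStructure m * (a : RMat m)) *
            (a⁻¹ : Matrix.orthogonalGroup (Fin (2 * m)) ℝ).val := by
          simp only [mul_assoc]
      _ = (a⁻¹ : Matrix.orthogonalGroup (Fin (2 * m)) ℝ).val * (a : RMat m) *
            (stdComplexStructure m * (a⁻¹ : Matrix.orthogonalGroup (Fin (2 * m)) ℝ).val) := by
          rw [← ha]; simp only [mul_assoc]
      _ = _ := by rw [h1, one_mul]

/-- The inner product `⟨X, Y⟩ = ½ tr(X Yᵗ) + ½ tr(B X B⁻¹ (B Y B⁻¹)ᵗ)` on the tangent space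
`gl(2m, ℝ)` of `GL(2m, ℝ)` at `B`. -/
noncomputable def glInner (m : ℕ) (B : RMat m) : LinearMap.BilinForm ℝ (RMat m) :=
  LinearMap.mk₂ ℝ
    (fun X Y => 1 / 2 * (X * Yᵀ).trace + 1 / 2 * ((B * X * B⁻¹) * (B * Y * B⁻¹)ᵀ).trace)
    (by intros; simp only [mul_add, add_mul, Matrix.trace_add]; ring)
    (by intros; simp only [Matrix.smul_mul, Matrix.mul_smul, Matrix.trace_smul, smul_eq_mul]; ring)
    (by intros; simp only [mul_add, add_mul, Matrix.transpose_add, Matrix.trace_add]; ring)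
    (by
      intros
      simp only [Matrix.smul_mul, Matrix.mul_smul, Matrix.transpose_smul, Matrix.trace_smul,
        smul_eq_mul]
      ring)

/-- The almost complex structure `J̃` on the twistor space: at `A` it is `X ↦ A X`. -/
def twistorJ (m : ℕ) (A : RMat m) : RMat m →ₗ[ℝ] RMat m := LinearMap.mulLeft ℝ A

/-- The metric `ds²(X, Y) = ½ ⟨X, Y⟩ + ½ ⟨J̃ X, J̃ Y⟩` on the twistor space. -/
noncomputable def twistorMetric (m : ℕ) (A : RMat m) : LinearMap.BilinForm ℝ (RMat m) :=
  (1 / 2 : ℝ) • glInner m A +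
    (1 / 2 : ℝ) • (glInner m A).compl₁₂ (twistorJ m A) (twistorJ m A)

/-- The fixed unit vector `e_(-1) = (1, 0, …, 0)` of `ℝ^(2n+2)`. -/
def poleVector (n : ℕ) : Fin (2 * (n + 1)) → ℝ := Pi.single ⟨0, by omega⟩ 1

/-- The sphere `S^(2n)` as the unit sphere of the hyperplane `e_(-1)^⊥` of `ℝ^(2n+2)`. -/
def equatorSphere (n : ℕ) : Set (Fin (2 * (n + 1)) → ℝ) :=
  {e | e ⬝ᵥ e = 1 ∧ e ⬝ᵥ poleVector n = 0}

/-- The tangent space of `S^(2n)` at its point `e`, as a subset of `ℝ^(2n+2)`: the vectors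
perpendicular to `e_(-1)` and `e`. -/
def sphereTangent (n : ℕ) (e : Fin (2 * (n + 1)) → ℝ) : Set (Fin (2 * (n + 1)) → ℝ) :=
  {v | v ⬝ᵥ poleVector n = 0 ∧ v ⬝ᵥ e = 0}

/-- The twistor space `𝒥(S^(2n))`: the complex structures `A` on `ℝ^(2n+2)` for which
`e = A e_(-1)` lies on `S^(2n)` and which map `T_e S^(2n)` to itself. Such an `A` stands for the
point `e` together with the complex structure that `A` induces on `T_e S^(2n)`. -/
def sphereTwistorSpace (n : ℕ) : Set (RMat (n + 1)) :=
  {A | A ∈ twistorSpace (n + 1) ∧ A *ᵥ poleVector n ∈ equatorSphere n ∧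
    ∀ v ∈ sphereTangent n (A *ᵥ poleVector n), A *ᵥ v ∈ sphereTangent n (A *ᵥ poleVector n)}

/-- The orthogonal twistor space of `S^(2n)`: those elements `A` of `𝒥(S^(2n))` for which the
complex structure induced on the tangent space of the sphere is orthogonal. -/
def sphereOrthTwistorSpace (n : ℕ) : Set (RMat (n + 1)) :=
  {A | A ∈ sphereTwistorSpace n ∧ ∀ v ∈ sphereTangent n (A *ᵥ poleVector n),
    ∀ w ∈ sphereTangent n (A *ᵥ poleVector n), (A *ᵥ v) ⬝ᵥ (A *ᵥ w) = v ⬝ᵥ w}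

end TwistorSpaces

/-!
The proof rests on three facts about complex structures.

*Transitivity.* A complex structure is orthogonal iff it is skew. For such an `A`, vectors
`v 0, A v 0, v 1, A v 1, …` forming an orthonormal basis can be chosen one pair at a time, and the
orthogonal matrix with these columns conjugates `J₀` to `A` (`exists_orthogonal_mul_std_eq`). So the
orbit map `g ↦ g J₀ g⁻¹` is onto, and its factorization through the compact space
`O(2m) / U(m)` is a homeomorphism (`exists_homeomorph_orthTwistorSpace`). For an arbitrary complex
structure `A`, the inner product `1 + Aᵀ A` is `A`-invariant, which reduces to the orthogonal case
(`exists_isUnit_mul_std_eq`).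

*Charts.* The Cayley transform `X ↦ (1 + X) J₀ (1 + X)⁻¹` maps the antilinear `X` with `1 + X`
invertible bijectively onto the complex structures `B` with `1 - J₀ B` invertible, and skew `X`
correspond to orthogonal `B`. It intertwines `X ↦ J₀ X` with `J̃`. Conjugating it by
the `g` above gives holomorphic charts around every point of both twistor spaces
(`exists_holomorphicParametrization`); their dimension is that of a fixed space of
antilinear matrices, whatever the point. Tangent spaces, defined by velocities of curves, are the
ranges of the differentials of charts (`IsLocalParametrization.tangentVectors_eq`), so their
invariance under `J̃` follows.

*Closedness.* On the orthogonal twistor space the fundamental form is `ω(X, Y) = -tr(A X Y)`, the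
restriction of the form `-½ tr(A (X Y - Y X))` on the ambient space of matrices
(`twistorMetric_mul_left`). The latter is linear in `A`, so its exterior derivative is a combination
of terms `tr(X Y Z)`. These vanish on the tangent space at `A`: there `X Y Z` anticommutes with `A`,
hence is conjugate to its negative (`trace_mul_mul_eq_zero`).
-/

/-! ### Submanifolds and their local parametrizations -/

section General

variable {E : Type*} [NormedAddCommGroup E] [NormedSpace ℝ E]

theorem IsLocalParametrization.differentiableAt {d : ℕ} {M : Set E} {V : Set (ComplexModel d)}
    {ψ : ComplexModel d → E} (h : IsLocalParametrization M V ψ) {z : ComplexModel d}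
    (hz : z ∈ V) : DifferentiableAt ℝ ψ z :=
  (h.smooth.contDiffAt (h.isOpen.mem_nhds hz)).differentiableAt (by simp)

theorem IsLocalParametrization.mem {d : ℕ} {M : Set E} {V : Set (ComplexModel d)}
    {ψ : ComplexModel d → E} (h : IsLocalParametrization M V ψ) {z : ComplexModel d}
    (hz : z ∈ V) : ψ z ∈ M := by
  obtain ⟨U, χ, -, -, him, -⟩ := h.exists_coordinates
  exact (him ▸ Set.mem_image_of_mem ψ hz : ψ z ∈ M ∩ U).1

theorem IsLocalParametrization.tangentVectors_eq {d : ℕ} {M : Set E} {V : Set (ComplexModel d)}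
    {ψ : ComplexModel d → E} (h : IsLocalParametrization M V ψ) {z : ComplexModel d}
    (hz : z ∈ V) : tangentVectors M (ψ z) = Set.range (fderiv ℝ ψ z) := by
  have hψ := h.smooth.contDiffAt (h.isOpen.mem_nhds hz)
  ext v
  constructor
  · rintro ⟨γ, hγ, hγ0, hγM, hγv⟩
    obtain ⟨U, χ, hU, hχ, him, hinv⟩ := h.exists_coordinates
    have hzU : ψ z ∈ U := (him ▸ Set.mem_image_of_mem ψ hz : ψ z ∈ M ∩ U).2
    have hχd : DifferentiableAt ℝ χ (γ 0) := by
      rw [hγ0]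
      exact (hχ.contDiffAt (hU.mem_nhds hzU)).differentiableAt (by simp)
    have hψd : DifferentiableAt ℝ ψ (χ (γ 0)) := by
      rw [hγ0, hinv z hz]
      exact h.differentiableAt hz
    -- A curve in `M` factors through the chart.
    have heq : γ =ᶠ[nhds 0] fun t => ψ (χ (γ t)) := by
      have hγU : ∀ᶠ t in nhds (0 : ℝ), γ t ∈ U :=
        hγ.continuousAt.eventually_mem (hU.mem_nhds (hγ0 ▸ hzU))
      filter_upwards [hγM, hγU] with t htM htU
      obtain ⟨w, hw, hwt⟩ : γ t ∈ ψ '' V := him ▸ ⟨htM, htU⟩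
      rw [← hwt, hinv w hw]
    have hd : HasDerivAt (fun t => ψ (χ (γ t)))
        (fderiv ℝ ψ (χ (γ 0)) (fderiv ℝ χ (γ 0) v)) 0 := by
      have h1 : HasDerivAt (fun t => χ (γ t)) (fderiv ℝ χ (γ 0) v) 0 :=
        hχd.hasFDerivAt.comp_hasDerivAt (0 : ℝ) hγv
      exact hψd.hasFDerivAt.comp_hasDerivAt (0 : ℝ) h1
    refine ⟨fderiv ℝ χ (γ 0) v, ?_⟩
    have hχz : χ (γ 0) = z := by rw [hγ0, hinv z hz]
    have := (hd.congr_of_eventuallyEq heq).unique hγv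
    rwa [hχz] at this
  · rintro ⟨u, rfl⟩
    have hline : HasDerivAt (fun t : ℝ => z + t • u) u 0 := by
      simpa using ((hasDerivAt_id (0 : ℝ)).smul_const u).const_add z
    have h0 : z + (0 : ℝ) • u = z := by simp
    refine ⟨fun t => ψ (z + t • u), ?_, by simp, ?_, ?_⟩
    · refine ContDiffAt.comp (0 : ℝ) (by simpa using hψ) ?_
      fun_prop
    · have : ∀ᶠ t in nhds (0 : ℝ), z + t • u ∈ V :=
        hline.continuousAt.eventually_mem (by simpa using h.isOpen.mem_nhds hz)
      filter_upwards [this] with t ht using h.mem ht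
    · have : HasFDerivAt ψ (fderiv ℝ ψ z) (z + (0 : ℝ) • u) := by
        rw [h0]; exact (h.differentiableAt hz).hasFDerivAt
      exact this.comp_hasDerivAt (0 : ℝ) hline

theorem IsLocalParametrization.fderiv_mem_tangentVectors {d : ℕ} {M : Set E}
    {V : Set (ComplexModel d)} {ψ : ComplexModel d → E} (h : IsLocalParametrization M V ψ)
    {z : ComplexModel d} (hz : z ∈ V) (u : ComplexModel d) :
    fderiv ℝ ψ z u ∈ tangentVectors M (ψ z) :=
  h.tangentVectors_eq hz ▸ Set.mem_range_self u

/-- The tangent spaces are ranges of differentials of charts, so holomorphic charts make them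
invariant under `J`. -/
theorem isComplexManifold_of_parametrizations {d : ℕ} {M : Set E} {J : E → E →ₗ[ℝ] E}
    (hsq : ∀ p ∈ M, ∀ v, J p (J p v) = -v)
    (hM : ∀ p ∈ M, ∃ (V : Set (ComplexModel d)) (ψ : ComplexModel d → E),
      IsHolomorphicParametrization M J V ψ ∧ p ∈ ψ '' V) : IsComplexManifold d M J where
  map_tangent := by
    intro p hp v hv
    obtain ⟨V, ψ, hψ, z, hz, rfl⟩ := hM p hp
    rw [hψ.tangentVectors_eq hz] at hv ⊢
    obtain ⟨u, rfl⟩ := hv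
    exact ⟨Complex.I • u, hψ.fderiv_I_smul z hz u⟩
  sq_eq_neg := fun p hp v _ => hsq p hp v
  exists_parametrization := hM

theorem IsComplexManifold.image_tangentVectors {d : ℕ} {M : Set E} {J : E → E →ₗ[ℝ] E}
    (h : IsComplexManifold d M J) {p : E} (hp : p ∈ M) :
    J p '' tangentVectors M p = tangentVectors M p := by
  apply Set.Subset.antisymm
  · rintro _ ⟨v, hv, rfl⟩
    exact h.map_tangent p hp v hv
  · intro v hv
    have h1 := h.map_tangent p hp v hv
    refine ⟨J p (J p (J p v)), h.map_tangent p hp _ (h.map_tangent p hp _ h1), ?_⟩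
    rw [h.sq_eq_neg p hp _ h1, map_neg, h.sq_eq_neg p hp v hv, neg_neg]

/-- A finite-dimensional real vector space with an endomorphism `j` of square `-1` is `ℂ^d`, with
`j` as multiplication by `i`. -/
theorem exists_complex_coordinates {W : Type*} [AddCommGroup W] [Module ℝ W]
    [FiniteDimensional ℝ W] (j : W →ₗ[ℝ] W) (hj : ∀ w, j (j w) = -w) :
    ∃ (d : ℕ) (L : ComplexModel d ≃ₗ[ℝ] W), ∀ u, L (Complex.I • u) = j (L u) := by
  have hj' : (j : Module.End ℝ W) * j = -1 := by
    ext w; exact hj w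
  let φ : ℂ →ₐ[ℝ] Module.End ℝ W := Complex.lift ⟨j, hj'⟩
  let _ : Module ℂ W := Module.compHom W φ.toRingHom
  have hsmul : ∀ (c : ℂ) (w : W), c • w = φ c w := fun _ _ => rfl
  have : IsScalarTower ℝ ℂ W := ⟨fun r c w => by
    rw [hsmul, hsmul, map_smul, LinearMap.smul_apply]⟩
  have : Module.Finite ℂ W := Module.Finite.of_restrictScalars_finite ℝ ℂ W
  refine ⟨Module.finrank ℂ W, ((WithLp.linearEquiv 2 ℂ _).trans
    (Module.finBasis ℂ W).equivFun.symm).restrictScalars ℝ, fun u => ?_⟩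
  have hI : ∀ w : W, Complex.I • w = j w := fun w => by
    rw [hsmul]
    simp [φ]
  rw [← hI]
  exact map_smul ((WithLp.linearEquiv 2 ℂ _).trans (Module.finBasis ℂ W).equivFun.symm) Complex.I u

/-- The alternating form `(u, v) ↦ B(u, v) - B(v, u)` of a bilinear form `B`, as a continuous
linear function of `B`. -/
noncomputable def alternatizeCLM (E : Type*) [NormedAddCommGroup E] [NormedSpace ℝ E] :
    (E →L[ℝ] E →L[ℝ] ℝ) →L[ℝ] E [⋀^Fin 2]→L[ℝ] ℝ :=
  (ContinuousAlternatingMap.alternatizeUncurryFinCLM ℝ E ℝ).comp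
    (ContinuousLinearMap.compL ℝ E (E →L[ℝ] ℝ) (E [⋀^Fin 1]→L[ℝ] ℝ)
      (ContinuousAlternatingMap.ofSubsingletonLIE (𝕜 := ℝ) (E := E) (F := ℝ)
        (0 : Fin 1)).toContinuousLinearEquiv.toContinuousLinearMap)

theorem alternatizeCLM_apply (B : E →L[ℝ] E →L[ℝ] ℝ) (v : Fin 2 → E) :
    alternatizeCLM E B v = B (v 0) (v 1) - B (v 1) (v 0) := by
  simp [alternatizeCLM, ContinuousAlternatingMap.alternatizeUncurryFin_apply, Fin.sum_univ_two,
    Fin.removeNth, sub_eq_add_neg]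

/-- Pullbacks of a 2-form on the ambient space that depends linearly on the base point. Its
exterior derivative involves only the values `β X Y Z` at tangent vectors. -/
theorem IsLocalParametrization.exists_closed_form {d : ℕ} {M : Set E}
    {V : Set (ComplexModel d)} {ψ : ComplexModel d → E} (h : IsLocalParametrization M V ψ)
    (β : E →L[ℝ] E →L[ℝ] E →L[ℝ] ℝ) (φ : E → E → E → ℝ)
    (hφ : ∀ p ∈ M, ∀ X ∈ tangentVectors M p, ∀ Y ∈ tangentVectors M p,
      β p X Y - β p Y X = φ p X Y)
    (hβ : ∀ p ∈ M, ∀ X ∈ tangentVectors M p, ∀ Y ∈ tangentVectors M p, ∀ Z ∈ tangentVectors M p,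
      β X Y Z = 0) :
    ∃ η : ComplexModel d → (ComplexModel d) [⋀^Fin 2]→L[ℝ] ℝ,
      ContDiffOn ℝ ∞ η V ∧
      (∀ z ∈ V, ∀ u w : ComplexModel d,
        η z ![u, w] = φ (ψ z) (fderiv ℝ ψ z u) (fderiv ℝ ψ z w)) ∧
      ∀ z ∈ V, extDeriv η z = 0 := by
  let Ω : E →L[ℝ] E [⋀^Fin 2]→L[ℝ] ℝ := alternatizeCLM E ∘L β
  have hΩ : ∀ p v, Ω p v = β p (v 0) (v 1) - β p (v 1) (v 0) := fun p v =>
    alternatizeCLM_apply (β p) v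
  refine ⟨fun z => (Ω (ψ z)).compContinuousLinearMap (fderiv ℝ ψ z), ?_, ?_, ?_⟩
  · have hD : ContDiffOn ℝ ∞ (fderiv ℝ ψ) V := h.smooth.fderiv_of_isOpen h.isOpen (by simp)
    have hB : ContDiffOn ℝ ∞
        (fun z => (β (ψ z)).bilinearComp (fderiv ℝ ψ z) (fderiv ℝ ψ z)) V := by
      refine contDiffOn_clm_apply.2 fun u => contDiffOn_clm_apply.2 fun w => ?_
      exact ((β.contDiff.comp_contDiffOn h.smooth).clm_apply
        (hD.clm_apply contDiffOn_const)).clm_apply (hD.clm_apply contDiffOn_const)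
    refine ((alternatizeCLM (ComplexModel d)).contDiff.comp_contDiffOn hB).congr fun z _ => ?_
    ext v
    change Ω (ψ z) (fderiv ℝ ψ z ∘ v) = alternatizeCLM (ComplexModel d) _ v
    rw [alternatizeCLM_apply, hΩ]
    rfl
  · intro z hz u w
    exact (hΩ (ψ z) (fderiv ℝ ψ z ∘ ![u, w])).trans (hφ _ (h.mem hz)
      _ (h.fderiv_mem_tangentVectors hz u) _ (h.fderiv_mem_tangentVectors hz w))
  · intro z hz
    have hle : (2 : WithTop ℕ∞) ≤ ∞ := WithTop.coe_le_coe.2 (le_top : (2 : ℕ∞) ≤ ⊤)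
    rw [extDeriv_pullback Ω.differentiableAt
      (h.smooth.contDiffAt (h.isOpen.mem_nhds hz)) (by simpa using hle)]
    ext v
    change extDeriv Ω (ψ z) (fderiv ℝ ψ z ∘ v) = 0
    have hT : ∀ i j k, β (fderiv ℝ ψ z (v i)) (fderiv ℝ ψ z (v j)) (fderiv ℝ ψ z (v k)) = 0 :=
      fun i j k => hβ _ (h.mem hz) _ (h.fderiv_mem_tangentVectors hz _)
        _ (h.fderiv_mem_tangentVectors hz _) _ (h.fderiv_mem_tangentVectors hz _)
    rw [extDeriv, ContinuousLinearMap.fderiv,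
      ContinuousAlternatingMap.alternatizeUncurryFin_apply]
    refine Finset.sum_eq_zero fun i _ => ?_
    rw [hΩ]
    simp only [Fin.removeNth, Function.comp_apply, hT, sub_self, smul_zero]

/-- The trilinear form `(x, y, z) ↦ τ(x y z)` of a linear form `τ` on a normed algebra. -/
noncomputable def tripleForm {R : Type*} [NormedRing R] [NormedAlgebra ℝ R] (τ : R →L[ℝ] ℝ) :
    R →L[ℝ] R →L[ℝ] R →L[ℝ] ℝ :=
  (ContinuousLinearMap.compL ℝ R R (R →L[ℝ] ℝ)
    ((ContinuousLinearMap.compL ℝ R R ℝ τ) ∘L ContinuousLinearMap.mul ℝ R)) ∘L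
      ContinuousLinearMap.mul ℝ R

end General

/-! ### Orthogonal complex structures and the homogeneous space -/

section Orthogonal

variable {m : ℕ}

theorem transpose_eq_neg_of_mem_orthTwistorSpace {A : RMat m} (hA : A ∈ orthTwistorSpace m) :
    Aᵀ = -A := by
  have h1 : A * A = -1 := hA.1
  have h2 : Aᵀ * A = 1 := (Matrix.mem_orthogonalGroup_iff' (Fin (2 * m)) ℝ).1 hA.2
  calc Aᵀ = -(Aᵀ * (A * A)) := by rw [h1]; simp
    _ = -A := by rw [← mul_assoc, h2, one_mul]

theorem mem_orthTwistorSpace_iff {A : RMat m} :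
    A ∈ orthTwistorSpace m ↔ A * A = -1 ∧ Aᵀ = -A := by
  refine ⟨fun h => ⟨h.1, transpose_eq_neg_of_mem_orthTwistorSpace h⟩, fun h => ⟨h.1, ?_⟩⟩
  refine (Matrix.mem_orthogonalGroup_iff' (Fin (2 * m)) ℝ).2 ?_
  change Aᵀ * A = 1
  rw [h.2, neg_mul, h.1, neg_neg]

theorem mul_stdComplexStructure_apply_of_even (X : RMat m) (i j : Fin (2 * m))
    (hj : j.val % 2 = 0) :
    (X * stdComplexStructure m) i j = X i ⟨j.val + 1, by omega⟩ := by
  rw [Matrix.mul_apply, Finset.sum_eq_single ⟨j.val + 1, by omega⟩]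
  · simp [stdComplexStructure, hj]
  · intro k _ hk
    have : k.val ≠ j.val + 1 := fun h => hk (Fin.ext h)
    have h2 : ¬ (k.val % 2 = 0 ∧ j.val = k.val + 1) := by omega
    simp [stdComplexStructure, hj, this, h2]
  · simp

theorem mul_stdComplexStructure_apply_of_odd (X : RMat m) (i j : Fin (2 * m))
    (hj : j.val % 2 = 1) :
    (X * stdComplexStructure m) i j = -X i ⟨j.val - 1, by omega⟩ := by
  rw [Matrix.mul_apply, Finset.sum_eq_single ⟨j.val - 1, by omega⟩]
  · have h1 : (j.val - 1) % 2 = 0 := by omega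
    have h2 : j.val = j.val - 1 + 1 := by omega
    simp [stdComplexStructure, hj, h1, ← h2]
  · intro k _ hk
    have : k.val ≠ j.val - 1 := fun h => hk (Fin.ext h)
    have h2 : ¬ (k.val % 2 = 0 ∧ j.val = k.val + 1) := by omega
    simp [stdComplexStructure, hj, h2]
  · simp

theorem stdComplexStructure_mul_self :
    stdComplexStructure m * stdComplexStructure m = -1 := by
  ext i j
  rcases Nat.mod_two_eq_zero_or_one j.val with hj | hj
  · rw [mul_stdComplexStructure_apply_of_even _ _ _ hj, stdComplexStructure, Matrix.of_apply,
      Matrix.neg_apply, Matrix.one_apply]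
    simp only [Fin.ext_iff]
    split_ifs <;> first | omega | simp
  · rw [mul_stdComplexStructure_apply_of_odd _ _ _ hj, stdComplexStructure, Matrix.of_apply,
      Matrix.neg_apply, Matrix.one_apply]
    simp only [Fin.ext_iff]
    split_ifs <;> first | omega | simp

theorem stdComplexStructure_mem_orthTwistorSpace :
    stdComplexStructure m ∈ orthTwistorSpace m := by
  refine mem_orthTwistorSpace_iff.2 ⟨stdComplexStructure_mul_self, ?_⟩
  ext i j
  simp only [Matrix.transpose_apply, Matrix.neg_apply, stdComplexStructure, Matrix.of_apply]
  split_ifs <;> first | omega | simp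

/-- A skew `A` with `A² = -1` has a complex orthonormal system of every size `k ≤ m`: a vector
orthogonal to the `2 k` vectors `v i`, `A v i` chosen so far exists by counting dimensions. -/
theorem exists_unitary_system {A : RMat m} (hA : A ∈ orthTwistorSpace m) :
    ∀ k ≤ m, ∃ v : Fin k → Fin (2 * m) → ℝ,
      (∀ i j, v i ⬝ᵥ v j = if i = j then 1 else 0) ∧ ∀ i j, v i ⬝ᵥ A *ᵥ v j = 0 := by
  have hskew : ∀ x y : Fin (2 * m) → ℝ, x ⬝ᵥ A *ᵥ y = -(y ⬝ᵥ A *ᵥ x) := by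
    intro x y
    rw [Matrix.dotProduct_mulVec, ← Matrix.mulVec_transpose,
      transpose_eq_neg_of_mem_orthTwistorSpace hA, Matrix.neg_mulVec, neg_dotProduct,
      dotProduct_comm]
  intro k
  induction k with
  | zero => exact fun _ => ⟨fun i => i.elim0, fun i => i.elim0, fun i => i.elim0⟩
  | succ k ih =>
    intro hk
    obtain ⟨v, hv, hvA⟩ := ih (by omega)
    let f : (Fin (2 * m) → ℝ) →ₗ[ℝ] (Fin k → ℝ) × (Fin k → ℝ) :=
      (Matrix.mulVecLin (Matrix.of v)).prod (Matrix.mulVecLin (Matrix.of fun i => A *ᵥ v i))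
    have hf : LinearMap.ker f ≠ ⊥ := LinearMap.ker_ne_bot_of_finrank_lt (by simp; omega)
    obtain ⟨w, hw, hw0⟩ := Submodule.exists_mem_ne_zero_of_ne_bot hf
    have hw1 : ∀ i, v i ⬝ᵥ w = 0 := fun i => congrFun (congrArg Prod.fst hw) i
    have hw2 : ∀ i, (A *ᵥ v i) ⬝ᵥ w = 0 := fun i => congrFun (congrArg Prod.snd hw) i
    have hpos : 0 < w ⬝ᵥ w := by
      have h0 : w ⬝ᵥ w ≠ 0 := fun h => hw0 (dotProduct_self_eq_zero.1 h)
      have h1 : 0 ≤ w ⬝ᵥ w := Finset.sum_nonneg fun i _ => mul_self_nonneg (w i)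
      exact lt_of_le_of_ne h1 h0.symm
    obtain ⟨u, hu1, hu2, huu⟩ : ∃ u : Fin (2 * m) → ℝ, (∀ i, v i ⬝ᵥ u = 0) ∧
        (∀ i, (A *ᵥ v i) ⬝ᵥ u = 0) ∧ u ⬝ᵥ u = 1 := by
      refine ⟨(√(w ⬝ᵥ w))⁻¹ • w, fun i => by simp [hw1], fun i => by simp [hw2], ?_⟩
      rw [smul_dotProduct, dotProduct_smul, smul_eq_mul, smul_eq_mul, ← mul_assoc, ← mul_inv,
        Real.mul_self_sqrt hpos.le, inv_mul_cancel₀ hpos.ne']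
    have huA : u ⬝ᵥ A *ᵥ u = 0 := by linarith [hskew u u]
    refine ⟨Fin.cons u v, ?_, ?_⟩
    · intro i j
      refine Fin.cases ?_ (fun i => ?_) i <;> refine Fin.cases ?_ (fun j => ?_) j
      · simp [huu]
      · simp [dotProduct_comm u, hu1, (Fin.succ_ne_zero j).symm]
      · simp [hu1]
      · simp [hv]
    · intro i j
      refine Fin.cases ?_ (fun i => ?_) i <;> refine Fin.cases ?_ (fun j => ?_) j
      · simp [huA]
      · simp [dotProduct_comm u, hu2]
      · rw [hskew]
        simp [dotProduct_comm u, hu2]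
      · simp [hvA]

/-- `O(2m)` acts transitively on the orthogonal complex structures. -/
theorem exists_orthogonal_mul_std_eq {A : RMat m} (hA : A ∈ orthTwistorSpace m) :
    ∃ g ∈ Matrix.orthogonalGroup (Fin (2 * m)) ℝ, g * stdComplexStructure m = A * g := by
  obtain ⟨v, hv, hvA⟩ := exists_unitary_system hA m le_rfl
  have hsq : ∀ x : Fin (2 * m) → ℝ, A *ᵥ A *ᵥ x = -x := fun x => by
    rw [Matrix.mulVec_mulVec, (hA.1 : A * A = -1), Matrix.neg_mulVec, Matrix.one_mulVec]
  have hAA : ∀ x y : Fin (2 * m) → ℝ, (A *ᵥ x) ⬝ᵥ (A *ᵥ y) = x ⬝ᵥ y := by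
    intro x y
    rw [Matrix.dotProduct_mulVec, ← Matrix.mulVec_transpose,
      transpose_eq_neg_of_mem_orthTwistorSpace hA, Matrix.neg_mulVec, hsq, neg_neg]
  -- The columns of `g` are `v 0, A v 0, v 1, A v 1, …`.
  let c : Fin (2 * m) → Fin (2 * m) → ℝ := fun j =>
    if j.val % 2 = 0 then v ⟨j.val / 2, by omega⟩ else A *ᵥ v ⟨j.val / 2, by omega⟩
  have hc : ∀ j k, c j ⬝ᵥ c k = if j = k then 1 else 0 := by
    intro j k
    have hiff : j.val % 2 = k.val % 2 → (j.val / 2 = k.val / 2 ↔ j = k) := fun h =>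
      ⟨fun h' => Fin.ext (by omega), fun h' => by rw [h']⟩
    have hne : j.val % 2 ≠ k.val % 2 → j ≠ k := fun h h' => h (by rw [h'])
    rcases Nat.mod_two_eq_zero_or_one j.val with hj | hj <;>
      rcases Nat.mod_two_eq_zero_or_one k.val with hk | hk
    · simp [c, hj, hk, hv, hiff (hj.trans hk.symm)]
    · simp [c, hj, hk, hvA, hne (by omega)]
    · simp [c, hj, hk, dotProduct_comm (A *ᵥ _), hvA, hne (by omega)]
    · simp [c, hj, hk, hv, hAA, hiff (hj.trans hk.symm)]
  refine ⟨(Matrix.of c)ᵀ, ?_, ?_⟩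
  · refine (Matrix.mem_orthogonalGroup_iff' (Fin (2 * m)) ℝ).2 ?_
    ext j k
    exact (hc j k).trans (Matrix.one_apply).symm
  · ext i j
    have hcol : ∀ j, (A * (Matrix.of c)ᵀ) i j = (A *ᵥ c j) i := fun j => rfl
    rw [hcol]
    rcases Nat.mod_two_eq_zero_or_one j.val with hj | hj
    · rw [mul_stdComplexStructure_apply_of_even _ _ _ hj]
      have h1 : (j.val + 1) % 2 ≠ 0 := by omega
      have h2 : (j.val + 1) / 2 = j.val / 2 := by omega
      simp [c, hj, h1, h2]
    · rw [mul_stdComplexStructure_apply_of_odd _ _ _ hj]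
      have h1 : (j.val - 1) % 2 = 0 := by omega
      have h2 : (j.val - 1) / 2 = j.val / 2 := by omega
      simp [c, hj, h1, h2, hsq]

open scoped MatrixOrder in
/-- For `S = 1 + Aᵀ A` one has `Aᵀ S A = S`; so if `S = Pᵀ P`, then `P A P⁻¹` is orthogonal, and
conjugate to the standard complex structure. -/
theorem exists_isUnit_mul_std_eq {A : RMat m} (hA : A ∈ twistorSpace m) :
    ∃ g : RMat m, IsUnit g ∧ g * stdComplexStructure m = A * g := by
  have hA' : A * A = -1 := hA
  have hS : (1 + Aᵀ * A).PosDef :=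
    Matrix.PosDef.one.add_posSemidef (Matrix.posSemidef_conjTranspose_mul_self A)
  obtain ⟨P, hPS⟩ : ∃ P : RMat m, 1 + Aᵀ * A = Pᵀ * P :=
    CStarAlgebra.nonneg_iff_eq_star_mul_self.mp hS.posSemidef.nonneg
  have hP : IsUnit P := by
    have h1 := hS.isUnit
    rw [hPS, Matrix.isUnit_iff_isUnit_det, Matrix.det_mul] at h1
    exact (Matrix.isUnit_iff_isUnit_det P).2 (isUnit_of_mul_isUnit_right h1)
  obtain ⟨Q, hPQ, hQP⟩ : ∃ Q : RMat m, P * Q = 1 ∧ Q * P = 1 := by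
    obtain ⟨u, rfl⟩ := hP
    exact ⟨↑u⁻¹, u.mul_inv, u.inv_mul⟩
  have hB : P * A * Q ∈ orthTwistorSpace m := by
    constructor
    · calc P * A * Q * (P * A * Q) = P * (A * (Q * P) * A) * Q := by simp only [mul_assoc]
        _ = -1 := by rw [hQP, mul_one, hA']; simp [hPQ]
    · refine (Matrix.mem_orthogonalGroup_iff' (Fin (2 * m)) ℝ).2 ?_
      have hinv : Aᵀ * (Pᵀ * P) * A = Pᵀ * P := by
        rw [← hPS, mul_add, add_mul, mul_one, ← mul_assoc, mul_assoc, hA', ← Matrix.transpose_mul,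
          hA']
        simp [add_comm]
      calc (P * A * Q)ᵀ * (P * A * Q) = Qᵀ * (Aᵀ * (Pᵀ * P) * A) * Q := by
            simp only [Matrix.transpose_mul, mul_assoc]
        _ = (P * Q)ᵀ * (P * Q) := by rw [hinv]; simp only [Matrix.transpose_mul, mul_assoc]
        _ = 1 := by rw [hPQ]; simp
  obtain ⟨h, hh, hhA⟩ := exists_orthogonal_mul_std_eq hB
  have hhu : IsUnit h := by
    have h1 := (Matrix.mem_orthogonalGroup_iff (Fin (2 * m)) ℝ).1 hh
    have h2 := (Matrix.mem_orthogonalGroup_iff' (Fin (2 * m)) ℝ).1 hh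
    exact ⟨⟨h, _, h1, h2⟩, rfl⟩
  refine ⟨Q * h, (IsUnit.mul ⟨⟨Q, P, hQP, hPQ⟩, rfl⟩ hhu), ?_⟩
  calc Q * h * stdComplexStructure m = Q * P * A * Q * h := by
        rw [mul_assoc, hhA]; simp only [mul_assoc]
    _ = A * (Q * h) := by rw [hQP, one_mul, mul_assoc]

theorem isCompact_orthogonalGroup :
    IsCompact (Matrix.orthogonalGroup (Fin (2 * m)) ℝ : Set (RMat m)) := by
  have hK : IsCompact {X : RMat m | ∀ i j, X i j ∈ Set.Icc (-1 : ℝ) 1} := by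
    have := isCompact_univ_pi fun _ : Fin (2 * m) =>
      isCompact_univ_pi fun _ : Fin (2 * m) => (isCompact_Icc (a := (-1 : ℝ)) (b := 1))
    simp only [Set.pi, Set.mem_univ, true_imp_iff] at this
    exact this
  refine hK.of_isClosed_subset ?_ ?_
  · have : (Matrix.orthogonalGroup (Fin (2 * m)) ℝ : Set (RMat m)) = {X | Xᵀ * X = 1} := by
      ext X; exact Matrix.mem_orthogonalGroup_iff' (Fin (2 * m)) ℝ
    rw [this]
    exact isClosed_eq (by fun_prop) continuous_const
  · intro X hX i j
    exact abs_le.1 (entry_norm_bound_of_unitary hX i j)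


/-- With `p = e_(-1)` and `e = A p`, the whole space is the orthogonal sum of `ℝ p`, `ℝ e` and the
tangent space of the sphere at `e`. As `A` rotates the orthonormal pair `p, e` by a right angle, it
is orthogonal as soon as it is so on the tangent space; conversely `A p ⊥ p` because an orthogonal
complex structure is skew. -/
theorem sphereOrthTwistorSpace_eq (n : ℕ) :
    sphereOrthTwistorSpace n = orthTwistorSpace (n + 1) := by
  have hpp : poleVector n ⬝ᵥ poleVector n = 1 := by simp [poleVector]
  ext A
  constructor
  · rintro ⟨⟨hA, ⟨hee, hep⟩, hT⟩, hO⟩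
    refine ⟨hA, ?_⟩
    have hsq : ∀ x : Fin (2 * (n + 1)) → ℝ, A *ᵥ A *ᵥ x = -x := fun x => by
      rw [Matrix.mulVec_mulVec, (hA : A * A = -1), Matrix.neg_mulVec, Matrix.one_mulVec]
    set p := poleVector n
    set e := A *ᵥ p with he
    have hpe : p ⬝ᵥ e = 0 := by rw [dotProduct_comm, hep]
    -- Split `x` into its components along `p` and `e` and the rest.
    have hdec : ∀ x, ∃ a b : ℝ, ∃ v ∈ sphereTangent n e, x = a • p + b • e + v := by
      intro x
      refine ⟨x ⬝ᵥ p, x ⬝ᵥ e, x - (x ⬝ᵥ p) • p - (x ⬝ᵥ e) • e, ⟨?_, ?_⟩, by abel⟩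
      · change _ ⬝ᵥ p = 0
        simp [sub_dotProduct, hpp, hep]
      · simp [sub_dotProduct, hee, hpe]
    have hpres : ∀ x y, (A *ᵥ x) ⬝ᵥ (A *ᵥ y) = x ⬝ᵥ y := by
      intro x y
      obtain ⟨a, b, v, hv, rfl⟩ := hdec x
      obtain ⟨a', b', w, hw, rfl⟩ := hdec y
      have hvw := hO v hv w hw
      have hAv := hT v hv
      have hAw := hT w hw
      have hAe : A *ᵥ e = -p := hsq p
      obtain ⟨h1, h2⟩ : v ⬝ᵥ p = 0 ∧ v ⬝ᵥ e = 0 := hv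
      obtain ⟨h3, h4⟩ : w ⬝ᵥ p = 0 ∧ w ⬝ᵥ e = 0 := hw
      obtain ⟨h5, h6⟩ : (A *ᵥ v) ⬝ᵥ p = 0 ∧ (A *ᵥ v) ⬝ᵥ e = 0 := hAv
      obtain ⟨h7, h8⟩ : (A *ᵥ w) ⬝ᵥ p = 0 ∧ (A *ᵥ w) ⬝ᵥ e = 0 := hAw
      rw [dotProduct_comm] at h3 h4 h7 h8
      simp only [Matrix.mulVec_add, Matrix.mulVec_smul, hAe, ← he, add_dotProduct, dotProduct_add,
        smul_dotProduct, dotProduct_smul, neg_dotProduct, dotProduct_neg, smul_eq_mul, hpp, hee,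
        hep, hpe, h1, h2, h3, h4, h5, h6, h7, h8, hvw]
      ring
    refine (Matrix.mem_orthogonalGroup_iff' _ ℝ).2 ?_
    change Aᵀ * A = 1
    ext i j
    have := hpres (Pi.single i 1) (Pi.single j 1)
    rw [Matrix.mulVec_single_one, Matrix.mulVec_single_one] at this
    simpa [Matrix.mul_apply, dotProduct, Matrix.one_apply, Pi.single_apply, eq_comm] using this
  · intro hA
    have hsq : ∀ x : Fin (2 * (n + 1)) → ℝ, A *ᵥ A *ᵥ x = -x := fun x => by
      rw [Matrix.mulVec_mulVec, (hA.1 : A * A = -1), Matrix.neg_mulVec, Matrix.one_mulVec]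
    have hadj : ∀ x y : Fin (2 * (n + 1)) → ℝ, (A *ᵥ x) ⬝ᵥ y = -(x ⬝ᵥ A *ᵥ y) := by
      intro x y
      rw [dotProduct_comm, Matrix.dotProduct_mulVec, ← Matrix.mulVec_transpose,
        transpose_eq_neg_of_mem_orthTwistorSpace hA, Matrix.neg_mulVec, neg_dotProduct,
        dotProduct_comm]
    have hpres : ∀ x y : Fin (2 * (n + 1)) → ℝ, (A *ᵥ x) ⬝ᵥ (A *ᵥ y) = x ⬝ᵥ y := fun x y => by
      rw [hadj, hsq, dotProduct_neg, neg_neg]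
    refine ⟨⟨hA.1, ⟨by rw [hpres, hpp], ?_⟩, fun v hv => ⟨?_, ?_⟩⟩, fun v _ w _ => hpres v w⟩
    · have := hadj (poleVector n) (poleVector n)
      rw [dotProduct_comm (poleVector n)] at this
      linarith
    · rw [hadj, hv.2, neg_zero]
    · rw [hpres, hv.1]

theorem conj_std_mem_orthTwistorSpace (h : Matrix.orthogonalGroup (Fin (2 * m)) ℝ) :
    (h : RMat m) * stdComplexStructure m * (h : RMat m)ᵀ ∈ orthTwistorSpace m := by
  have h1 : (h : RMat m)ᵀ * h = 1 := (Matrix.mem_orthogonalGroup_iff' _ ℝ).1 h.2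
  have h2 : (h : RMat m) * (h : RMat m)ᵀ = 1 := (Matrix.mem_orthogonalGroup_iff _ ℝ).1 h.2
  have hJ := mem_orthTwistorSpace_iff.1 (stdComplexStructure_mem_orthTwistorSpace (m := m))
  refine mem_orthTwistorSpace_iff.2 ⟨?_, ?_⟩
  · calc _ = (h : RMat m) * (stdComplexStructure m * ((h : RMat m)ᵀ * h) * stdComplexStructure m) *
          (h : RMat m)ᵀ := by simp only [mul_assoc]
      _ = -1 := by rw [h1, mul_one, hJ.1]; simp [h2]
  · rw [Matrix.transpose_mul, Matrix.transpose_mul, hJ.2, Matrix.transpose_transpose]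
    simp [mul_assoc]

/-- The orbit map `g ↦ g J₀ g⁻¹` descends to a continuous bijection from a compact space onto a
Hausdorff space. -/
theorem exists_homeomorph_orthTwistorSpace (m : ℕ) :
    ∃ Φ : (Matrix.orthogonalGroup (Fin (2 * m)) ℝ ⧸ unitaryStabilizer m) ≃ₜ orthTwistorSpace m,
      ∀ h : Matrix.orthogonalGroup (Fin (2 * m)) ℝ,
        (Φ (QuotientGroup.mk h) : RMat m) =
          (h : RMat m) * stdComplexStructure m * (h : RMat m)⁻¹ := by
  have hl : ∀ h : Matrix.orthogonalGroup (Fin (2 * m)) ℝ, (h : RMat m)ᵀ * h = 1 :=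
    fun h => (Matrix.mem_orthogonalGroup_iff' _ ℝ).1 h.2
  have hr : ∀ h : Matrix.orthogonalGroup (Fin (2 * m)) ℝ, (h : RMat m) * (h : RMat m)ᵀ = 1 :=
    fun h => (Matrix.mem_orthogonalGroup_iff _ ℝ).1 h.2
  let f : Matrix.orthogonalGroup (Fin (2 * m)) ℝ → orthTwistorSpace m := fun h =>
    ⟨_, conj_std_mem_orthTwistorSpace h⟩
  have hf : Continuous f := by
    refine Continuous.subtype_mk ?_ _
    have : Continuous fun h : Matrix.orthogonalGroup (Fin (2 * m)) ℝ => (h : RMat m) :=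
      continuous_subtype_val
    fun_prop
  have hfib : ∀ a b, a⁻¹ * b ∈ unitaryStabilizer m ↔ f a = f b := by
    intro a b
    have hmem : a⁻¹ * b ∈ unitaryStabilizer m ↔
        (a : RMat m)ᵀ * b * stdComplexStructure m = stdComplexStructure m * ((a : RMat m)ᵀ * b) :=
      Iff.rfl
    rw [hmem, Subtype.ext_iff]
    change _ ↔ (a : RMat m) * stdComplexStructure m * (a : RMat m)ᵀ =
      (b : RMat m) * stdComplexStructure m * (b : RMat m)ᵀ
    constructor
    · intro h
      calc (a : RMat m) * stdComplexStructure m * (a : RMat m)ᵀ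
          = a * (stdComplexStructure m * ((a : RMat m)ᵀ * b)) * (b : RMat m)ᵀ := by
            rw [mul_assoc _ _ (b : RMat m)ᵀ, mul_assoc _ _ (b : RMat m)ᵀ,
              mul_assoc _ _ (b : RMat m)ᵀ, hr b, mul_one, mul_assoc]
        _ = a * (a : RMat m)ᵀ * (b * stdComplexStructure m * (b : RMat m)ᵀ) := by
            rw [← h]; simp only [mul_assoc]
        _ = _ := by rw [hr a, one_mul]
    · intro h
      calc (a : RMat m)ᵀ * b * stdComplexStructure m
          = (a : RMat m)ᵀ * (b * stdComplexStructure m * (b : RMat m)ᵀ) * b := by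
            simp only [mul_assoc]; rw [hl b, mul_one]
        _ = (a : RMat m)ᵀ * a * stdComplexStructure m * ((a : RMat m)ᵀ * b) := by
            rw [← h]; simp only [mul_assoc]
        _ = _ := by rw [hl a, one_mul]
  let F : (Matrix.orthogonalGroup (Fin (2 * m)) ℝ ⧸ unitaryStabilizer m) → orthTwistorSpace m :=
    Quotient.lift f fun a b hab => (hfib a b).1 (QuotientGroup.leftRel_apply.1 hab)
  have hFc : Continuous F := hf.quotient_lift _
  have hFb : Function.Bijective F := by
    constructor
    · intro x y
      refine Quotient.inductionOn₂ x y fun a b hab => ?_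
      exact QuotientGroup.eq.2 ((hfib a b).2 hab)
    · rintro ⟨A, hA⟩
      obtain ⟨g, hg, hgA⟩ := exists_orthogonal_mul_std_eq hA
      refine ⟨QuotientGroup.mk ⟨g, hg⟩, Subtype.ext ?_⟩
      change g * stdComplexStructure m * gᵀ = A
      rw [hgA, mul_assoc, hr ⟨g, hg⟩, mul_one]
  have : CompactSpace (Matrix.orthogonalGroup (Fin (2 * m)) ℝ) :=
    isCompact_iff_compactSpace.1 isCompact_orthogonalGroup
  have : CompactSpace (Matrix.orthogonalGroup (Fin (2 * m)) ℝ ⧸ unitaryStabilizer m) :=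
    Quotient.compactSpace
  have hFc' : Continuous (Equiv.ofBijective F hFb) := hFc
  refine ⟨hFc'.homeoOfEquivCompactToT2, fun h => ?_⟩
  change (h : RMat m) * stdComplexStructure m * (h : RMat m)ᵀ = _
  rw [Matrix.inv_eq_left_inv (hl h)]

end Orthogonal

/-! ### The Cayley transform and holomorphic charts -/

section Cayley

variable {m : ℕ}

theorem contDiffAt_matrix_inv {A : RMat m} (hA : IsUnit A) :
    ContDiffAt ℝ ∞ (fun X : RMat m => X⁻¹) A := by
  have : CompleteSpace (RMat m) := FiniteDimensional.complete ℝ _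
  obtain ⟨u, rfl⟩ := hA
  simp_rw [Matrix.nonsing_inv_eq_ringInverse]
  exact contDiffAt_ringInverse ℝ u

theorem isOpen_setOf_isUnit_matrix : IsOpen {A : RMat m | IsUnit A} := by
  have : CompleteSpace (RMat m) := FiniteDimensional.complete ℝ _
  exact Units.isOpen

theorem mul_inv_of_isUnit {A : RMat m} (hA : IsUnit A) : A * A⁻¹ = 1 :=
  Matrix.mul_nonsing_inv A ((Matrix.isUnit_iff_isUnit_det A).1 hA)

theorem inv_mul_of_isUnit {A : RMat m} (hA : IsUnit A) : A⁻¹ * A = 1 :=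
  Matrix.nonsing_inv_mul A ((Matrix.isUnit_iff_isUnit_det A).1 hA)

/-- The Cayley transform of `X`: the complex structure `J₀` conjugated by `1 + X`. It is meaningful
only where `1 + X` is invertible. -/
noncomputable def cayley (m : ℕ) (X : RMat m) : RMat m :=
  (1 + X) * stdComplexStructure m * (1 + X)⁻¹

/-- The inverse Cayley transform, defined at those `B` for which `1 - J₀ B` is invertible. -/
noncomputable def cayleyInv (m : ℕ) (B : RMat m) : RMat m :=
  (1 + stdComplexStructure m * B) * (1 - stdComplexStructure m * B)⁻¹

theorem cayley_mul_self {X : RMat m} (hu : IsUnit (1 + X)) : cayley m X * cayley m X = -1 := by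
  have h1 := inv_mul_of_isUnit hu
  have h2 := mul_inv_of_isUnit hu
  calc cayley m X * cayley m X = (1 + X) * (stdComplexStructure m * ((1 + X)⁻¹ * (1 + X)) *
        stdComplexStructure m) * (1 + X)⁻¹ := by simp only [cayley, mul_assoc]
    _ = -1 := by rw [h1, mul_one, stdComplexStructure_mul_self, mul_neg_one, neg_mul, h2]

theorem std_mul_cayley_mul {X : RMat m}
    (hX : X * stdComplexStructure m = -(stdComplexStructure m * X)) (hu : IsUnit (1 + X)) :
    stdComplexStructure m * cayley m X * (1 + X) = X - 1 := by
  have hJ := stdComplexStructure_mul_self (m := m)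
  calc stdComplexStructure m * cayley m X * (1 + X)
      = stdComplexStructure m * ((1 + X) * stdComplexStructure m) * ((1 + X)⁻¹ * (1 + X)) := by
        simp only [cayley, mul_assoc]
    _ = stdComplexStructure m * stdComplexStructure m * (1 - X) := by
        rw [inv_mul_of_isUnit hu, mul_one, add_mul, hX]; noncomm_ring
    _ = X - 1 := by rw [hJ]; noncomm_ring

theorem one_sub_std_mul_cayley {X : RMat m}
    (hX : X * stdComplexStructure m = -(stdComplexStructure m * X)) (hu : IsUnit (1 + X)) :
    (1 - stdComplexStructure m * cayley m X) * ((1 / 2 : ℝ) • (1 + X)) = 1 := by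
  rw [mul_smul_comm, sub_mul, std_mul_cayley_mul hX hu, one_mul]
  have : 1 + X - (X - 1) = (2 : ℝ) • (1 : RMat m) := by rw [two_smul]; abel
  rw [this, smul_smul]
  norm_num

theorem isUnit_one_sub_std_mul_cayley {X : RMat m}
    (hX : X * stdComplexStructure m = -(stdComplexStructure m * X)) (hu : IsUnit (1 + X)) :
    IsUnit (1 - stdComplexStructure m * cayley m X) := by
  have h := one_sub_std_mul_cayley hX hu
  exact ⟨⟨_, _, h, mul_eq_one_comm.1 h⟩, rfl⟩

theorem cayleyInv_cayley {X : RMat m}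
    (hX : X * stdComplexStructure m = -(stdComplexStructure m * X)) (hu : IsUnit (1 + X)) :
    cayleyInv m (cayley m X) = X := by
  rw [cayleyInv, Matrix.inv_eq_right_inv (one_sub_std_mul_cayley hX hu), mul_smul_comm, add_mul,
    std_mul_cayley_mul hX hu, one_mul]
  have : 1 + X + (X - 1) = (2 : ℝ) • X := by rw [two_smul]; abel
  rw [this, smul_smul]
  norm_num

theorem one_add_cayleyInv {B : RMat m} (hu : IsUnit (1 - stdComplexStructure m * B)) :
    1 + cayleyInv m B = (2 : ℝ) • (1 - stdComplexStructure m * B)⁻¹ := by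
  set D := 1 - stdComplexStructure m * B with hD
  calc 1 + cayleyInv m B = D * D⁻¹ + (1 + stdComplexStructure m * B) * D⁻¹ := by
        rw [mul_inv_of_isUnit hu]; rfl
    _ = (2 : ℝ) • D⁻¹ := by
        rw [← add_mul, hD]
        have : 1 - stdComplexStructure m * B + (1 + stdComplexStructure m * B) =
          (2 : ℝ) • (1 : RMat m) := by rw [two_smul]; abel
        rw [this, smul_mul_assoc, one_mul]

theorem one_add_cayleyInv_mul {B : RMat m} (hu : IsUnit (1 - stdComplexStructure m * B)) :
    (1 + cayleyInv m B) * ((1 / 2 : ℝ) • (1 - stdComplexStructure m * B)) = 1 := by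
  rw [one_add_cayleyInv hu, smul_mul_smul_comm, inv_mul_of_isUnit hu]
  norm_num

theorem isUnit_one_add_cayleyInv {B : RMat m} (hu : IsUnit (1 - stdComplexStructure m * B)) :
    IsUnit (1 + cayleyInv m B) := by
  have h := one_add_cayleyInv_mul hu
  exact ⟨⟨_, _, h, mul_eq_one_comm.1 h⟩, rfl⟩

/-- `1 - J₀ B` intertwines `B` and `J₀`. -/
theorem one_sub_std_mul_mul {B : RMat m} (hB : B * B = -1) :
    (1 - stdComplexStructure m * B) * B =
      stdComplexStructure m * (1 - stdComplexStructure m * B) := by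
  rw [sub_mul, mul_sub, mul_assoc, hB, ← mul_assoc, stdComplexStructure_mul_self]
  noncomm_ring

theorem cayley_cayleyInv {B : RMat m} (hB : B * B = -1)
    (hu : IsUnit (1 - stdComplexStructure m * B)) : cayley m (cayleyInv m B) = B := by
  rw [cayley, Matrix.inv_eq_right_inv (one_add_cayleyInv_mul hu), one_add_cayleyInv hu,
    smul_mul_assoc, smul_mul_smul_comm, mul_assoc, ← one_sub_std_mul_mul hB, ← mul_assoc,
    inv_mul_of_isUnit hu]
  norm_num

theorem cayleyInv_mul_std {B : RMat m} (hB : B * B = -1)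
    (hu : IsUnit (1 - stdComplexStructure m * B)) :
    cayleyInv m B * stdComplexStructure m = -(stdComplexStructure m * cayleyInv m B) := by
  have h1 : (1 - stdComplexStructure m * B)⁻¹ * stdComplexStructure m =
      B * (1 - stdComplexStructure m * B)⁻¹ := by
    calc _ = (1 - stdComplexStructure m * B)⁻¹ *
          (stdComplexStructure m * (1 - stdComplexStructure m * B)) *
            (1 - stdComplexStructure m * B)⁻¹ := by
          simp only [mul_assoc]; rw [mul_inv_of_isUnit hu, mul_one]
      _ = _ := by rw [← one_sub_std_mul_mul hB, ← mul_assoc, inv_mul_of_isUnit hu, one_mul]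
  have h2 : (1 + stdComplexStructure m * B) * B =
      -(stdComplexStructure m * (1 + stdComplexStructure m * B)) := by
    rw [add_mul, mul_add, mul_assoc, hB, ← mul_assoc, stdComplexStructure_mul_self]
    noncomm_ring
  rw [cayleyInv, mul_assoc, h1, ← mul_assoc, h2]
  noncomm_ring

theorem transpose_cayley {X : RMat m}
    (hX : X * stdComplexStructure m = -(stdComplexStructure m * X)) (hXt : Xᵀ = -X)
    (hu : IsUnit (1 + X)) : (cayley m X)ᵀ = -cayley m X := by
  have hJt := transpose_eq_neg_of_mem_orthTwistorSpace
    (stdComplexStructure_mem_orthTwistorSpace (m := m))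
  have ht : (1 + X)ᵀ = 1 - X := by rw [Matrix.transpose_add, hXt]; simp [sub_eq_add_neg]
  have hu' : IsUnit (1 - X) := by rw [← ht]; exact (Matrix.isUnit_transpose _).2 hu
  have hcomm : stdComplexStructure m * (1 - X) * (1 + X) =
      (1 - X) * (1 + X) * stdComplexStructure m := by
    have : X * X * stdComplexStructure m = stdComplexStructure m * (X * X) := by
      rw [mul_assoc, hX, mul_neg, ← mul_assoc, hX, neg_mul, neg_neg, mul_assoc]
    have h2 : (1 - X) * (1 + X) = 1 - X * X := by noncomm_ring
    rw [mul_assoc, h2, sub_mul, mul_sub, this]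
    simp
  rw [cayley, Matrix.transpose_mul, Matrix.transpose_mul, hJt, Matrix.transpose_nonsing_inv, ht]
  calc (1 - X)⁻¹ * (-stdComplexStructure m * (1 - X))
      = -((1 - X)⁻¹ * (stdComplexStructure m * (1 - X) * (1 + X)) * (1 + X)⁻¹) := by
        simp only [mul_assoc]; rw [mul_inv_of_isUnit hu]; simp
    _ = -((1 - X)⁻¹ * (1 - X) * (1 + X) * stdComplexStructure m * (1 + X)⁻¹) := by
        rw [hcomm]; simp only [mul_assoc]
    _ = _ := by rw [inv_mul_of_isUnit hu', one_mul]

theorem transpose_cayleyInv {B : RMat m} (hB : B ∈ orthTwistorSpace m)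
    (hu : IsUnit (1 - stdComplexStructure m * B)) : (cayleyInv m B)ᵀ = -cayleyInv m B := by
  have hJt := transpose_eq_neg_of_mem_orthTwistorSpace
    (stdComplexStructure_mem_orthTwistorSpace (m := m))
  have hBt := transpose_eq_neg_of_mem_orthTwistorSpace hB
  set C := stdComplexStructure m * B with hC
  have hCt : Cᵀ * C = 1 := by
    have hBB : B * B = -1 := hB.1
    calc Cᵀ * C = B * (stdComplexStructure m * stdComplexStructure m) * B := by
          rw [hC, Matrix.transpose_mul, hJt, hBt]; noncomm_ring
      _ = 1 := by rw [stdComplexStructure_mul_self, mul_neg_one, neg_mul, hBB, neg_neg]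
  have hut : IsUnit (1 - Cᵀ) := by
    have := (Matrix.isUnit_transpose _).2 hu
    rwa [Matrix.transpose_sub, Matrix.transpose_one] at this
  have key : (1 + Cᵀ) * (1 - C) = -((1 - Cᵀ) * (1 + C)) := by
    have h1 : (1 + Cᵀ) * (1 - C) = 1 - C + Cᵀ - Cᵀ * C := by noncomm_ring
    have h2 : (1 - Cᵀ) * (1 + C) = 1 + C - Cᵀ - Cᵀ * C := by noncomm_ring
    rw [h1, h2, hCt]; abel
  have hX : cayleyInv m B = (1 + C) * (1 - C)⁻¹ := rfl
  rw [hX, Matrix.transpose_mul, Matrix.transpose_nonsing_inv, Matrix.transpose_sub,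
    Matrix.transpose_add, Matrix.transpose_one]
  calc (1 - Cᵀ)⁻¹ * (1 + Cᵀ) = (1 - Cᵀ)⁻¹ * ((1 + Cᵀ) * (1 - C)) * (1 - C)⁻¹ := by
        simp only [mul_assoc]; rw [mul_inv_of_isUnit hu, mul_one]
    _ = -((1 - Cᵀ)⁻¹ * (1 - Cᵀ) * (1 + C) * (1 - C)⁻¹) := by
        rw [key]; simp only [mul_assoc, mul_neg, neg_mul]
    _ = _ := by rw [inv_mul_of_isUnit hut, one_mul]

/-- The conjugate by `g` of the Cayley transform is a holomorphic chart. If `ψ` denotes it and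
`Z = 1 + X`, then `ψ (g Z) = (g Z) J₀`, so `dψ(X) g Z = -(g J₀ + ψ g) X` because `X` anticommutes
with `J₀`; replacing `X` by `J₀ X` on the right amounts to multiplying by `ψ` on the left. -/
theorem exists_holomorphicParametrization {d : ℕ} {W : Submodule ℝ (RMat m)}
    (hW : ∀ X ∈ W, X * stdComplexStructure m = -(stdComplexStructure m * X))
    (L : ComplexModel d ≃ₗ[ℝ] W)
    (hL : ∀ u, (L (Complex.I • u) : RMat m) = stdComplexStructure m * L u)
    {N : Set (RMat m)} {g : RMat m} (hgu : IsUnit g) (hsq : ∀ A ∈ N, A * A = -1)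
    (hg : ∀ B, g * B * g⁻¹ ∈ N ↔ B ∈ N)
    (h1 : ∀ X ∈ W, IsUnit (1 + X) → cayley m X ∈ N)
    (h2 : ∀ B ∈ N, IsUnit (1 - stdComplexStructure m * B) → cayleyInv m B ∈ W) :
    ∃ (V : Set (ComplexModel d)) (ψ : ComplexModel d → RMat m),
      IsHolomorphicParametrization N (twistorJ m) V ψ ∧
        g * stdComplexStructure m * g⁻¹ ∈ ψ '' V := by
  have hgi := inv_mul_of_isUnit hgu
  have hgr := mul_inv_of_isUnit hgu
  have hcan : ∀ A : RMat m, g * (g⁻¹ * A * g) * g⁻¹ = A := fun A => by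
    simp only [← mul_assoc, hgr, one_mul]; rw [mul_assoc, hgr, mul_one]
  have hcan' : ∀ A : RMat m, g⁻¹ * (g * A * g⁻¹) * g = A := fun A => by
    simp only [← mul_assoc, hgi, one_mul]; rw [mul_assoc, hgi, mul_one]
  let ℓ : ComplexModel d →L[ℝ] RMat m :=
    LinearMap.toContinuousLinearMap (W.subtype ∘ₗ L.toLinearMap)
  have hℓ : ∀ z, ℓ z = (L z : RMat m) := fun _ => rfl
  have hℓW : ∀ z, ℓ z ∈ W := fun z => (L z).2
  obtain ⟨r, hr⟩ := (W.subtype ∘ₗ L.toLinearMap).exists_leftInverse_of_injective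
    (LinearMap.ker_eq_bot.2 (W.injective_subtype.comp L.injective))
  let ρ : RMat m →L[ℝ] ComplexModel d := LinearMap.toContinuousLinearMap r
  have hρ : ∀ z, ρ (ℓ z) = z := fun z => LinearMap.congr_fun hr z
  let V : Set (ComplexModel d) := {z | IsUnit (1 + ℓ z)}
  let U : Set (RMat m) := {A | IsUnit (1 - stdComplexStructure m * (g⁻¹ * A * g))}
  let ψ : ComplexModel d → RMat m := fun z => g * cayley m (ℓ z) * g⁻¹
  have hV : IsOpen V :=
    isOpen_setOf_isUnit_matrix.preimage (by fun_prop : Continuous fun z => 1 + ℓ z)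
  have hU : IsOpen U := isOpen_setOf_isUnit_matrix.preimage
    (by fun_prop : Continuous fun A : RMat m => 1 - stdComplexStructure m * (g⁻¹ * A * g))
  have hψ : ContDiffOn ℝ ∞ ψ V := by
    intro z hz
    have e1 : ContDiffAt ℝ ∞ (fun z => 1 + ℓ z) z := contDiffAt_const.add ℓ.contDiff.contDiffAt
    have e2 : ContDiffAt ℝ ∞ (fun z => (1 + ℓ z)⁻¹) z :=
      ContDiffAt.comp z (contDiffAt_matrix_inv (A := 1 + ℓ z) hz) e1
    exact ((contDiffAt_const.mul ((e1.mul contDiffAt_const).mul e2)).mul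
      contDiffAt_const).contDiffWithinAt
  have hχ : ContDiffOn ℝ ∞ (fun A => ρ (cayleyInv m (g⁻¹ * A * g))) U := by
    intro A hA
    have e0 : ContDiffAt ℝ ∞ (fun A : RMat m => stdComplexStructure m * (g⁻¹ * A * g)) A :=
      contDiffAt_const.mul ((contDiffAt_const.mul contDiffAt_id).mul contDiffAt_const)
    have e2 : ContDiffAt ℝ ∞ (fun A : RMat m => (1 - stdComplexStructure m * (g⁻¹ * A * g))⁻¹) A :=
      ContDiffAt.comp A (contDiffAt_matrix_inv
        (A := 1 - stdComplexStructure m * (g⁻¹ * A * g)) hA) (contDiffAt_const.sub e0)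
    exact (ρ.contDiff.contDiffAt.comp A
      ((contDiffAt_const.add e0).mul e2)).contDiffWithinAt
  have hψN : ∀ z ∈ V, ψ z ∈ N := fun z hz => (hg _).2 (h1 _ (hℓW z) hz)
  have himg : ψ '' V = N ∩ U := by
    ext A
    constructor
    · rintro ⟨z, hz, rfl⟩
      refine ⟨hψN z hz, ?_⟩
      change IsUnit (1 - stdComplexStructure m * (g⁻¹ * (g * cayley m (ℓ z) * g⁻¹) * g))
      rw [hcan']
      exact isUnit_one_sub_std_mul_cayley (hW _ (hℓW z)) hz
    · rintro ⟨hA, hAU⟩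
      have hB : g⁻¹ * A * g ∈ N := by rw [← hg, hcan]; exact hA
      let w : W := ⟨cayleyInv m (g⁻¹ * A * g), h2 _ hB hAU⟩
      have hw : ℓ (L.symm w) = cayleyInv m (g⁻¹ * A * g) := by rw [hℓ, L.apply_symm_apply]
      refine ⟨L.symm w, ?_, ?_⟩
      · change IsUnit (1 + ℓ (L.symm w))
        rw [hw]
        exact isUnit_one_add_cayleyInv hAU
      · change g * cayley m (ℓ (L.symm w)) * g⁻¹ = A
        rw [hw, cayley_cayleyInv (hsq _ hB) hAU, hcan]
  refine ⟨V, ψ, ⟨⟨hV, hψ, U, _, hU, hχ, himg, ?_⟩, ?_⟩, ?_⟩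
  · intro z hz
    change ρ (cayleyInv m (g⁻¹ * (g * cayley m (ℓ z) * g⁻¹) * g)) = z
    rw [hcan', cayleyInv_cayley (hW _ (hℓW z)) hz, hρ]
  · intro z hz u
    have hzu : IsUnit (1 + ℓ z) := hz
    have hd : DifferentiableAt ℝ ψ z :=
      (hψ.contDiffAt (hV.mem_nhds hz)).differentiableAt (by simp)
    have hZ : HasFDerivAt (fun z => g * (1 + ℓ z))
        ((ContinuousLinearMap.mul ℝ (RMat m) g) ∘L ℓ) z :=
      (ContinuousLinearMap.mul ℝ (RMat m) g).hasFDerivAt.comp z (ℓ.hasFDerivAt.const_add 1)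
    have hrel : (fun z => ψ z * (g * (1 + ℓ z))) =ᶠ[nhds z]
        fun z => g * (1 + ℓ z) * stdComplexStructure m := by
      filter_upwards [hV.mem_nhds hz] with y hy
      have hy' : IsUnit (1 + ℓ y) := hy
      calc g * cayley m (ℓ y) * g⁻¹ * (g * (1 + ℓ y))
          = g * (1 + ℓ y) * stdComplexStructure m * ((1 + ℓ y)⁻¹ * (g⁻¹ * g) * (1 + ℓ y)) := by
            simp only [cayley, mul_assoc]
        _ = _ := by rw [hgi, mul_one, inv_mul_of_isUnit hy', mul_one]
    have hD1 := hd.hasFDerivAt.mul' hZ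
    have hD2 := hZ.mul_const' (stdComplexStructure m)
    have hD := hD1.unique (hD2.congr_of_eventuallyEq hrel)
    have hform : ∀ u, fderiv ℝ ψ z u * (g * (1 + ℓ z)) =
        -((g * stdComplexStructure m + ψ z * g) * ℓ u) := by
      intro u
      have h3 : ψ z * (g * ℓ u) + fderiv ℝ ψ z u * (g * (1 + ℓ z)) =
          g * ℓ u * stdComplexStructure m := by
        have := DFunLike.congr_fun hD u
        exact this
      rw [eq_sub_of_add_eq' h3, mul_assoc, hW _ (hℓW u)]
      noncomm_ring
    have hsqψ : ψ z * ψ z = -1 := hsq _ (hψN z hz)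
    refine (hgu.mul hzu).mul_right_cancel ?_
    change fderiv ℝ ψ z (Complex.I • u) * (g * (1 + ℓ z)) =
      ψ z * fderiv ℝ ψ z u * (g * (1 + ℓ z))
    rw [hform, mul_assoc (ψ z), hform, hℓ, hL, ← hℓ]
    have h4 : (g * stdComplexStructure m + ψ z * g) * (stdComplexStructure m * ℓ u) =
        g * (stdComplexStructure m * stdComplexStructure m) * ℓ u +
          ψ z * g * stdComplexStructure m * ℓ u := by noncomm_ring
    have h5 : ψ z * -((g * stdComplexStructure m + ψ z * g) * ℓ u) =
        -(ψ z * g * stdComplexStructure m * ℓ u + ψ z * ψ z * g * ℓ u) := by noncomm_ring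
    rw [h4, h5, hsqψ, stdComplexStructure_mul_self]
    noncomm_ring
  · refine ⟨0, ?_, ?_⟩
    · change IsUnit (1 + ℓ 0)
      simp
    · change g * cayley m (ℓ 0) * g⁻¹ = _
      simp [cayley]

end Cayley

/-! ### The twistor spaces as complex manifolds -/

section ComplexManifolds

variable {m : ℕ}

/-- The real matrices that anticommute with `J₀`, i.e. the antilinear endomorphisms: the tangent
space of the twistor space at `J₀`. -/
def antilinearMatrices (m : ℕ) : Submodule ℝ (RMat m) where
  carrier := {X | X * stdComplexStructure m = -(stdComplexStructure m * X)}
  add_mem' := by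
    intro X Y (hX : _ = _) (hY : _ = _)
    change _ = _
    rw [add_mul, hX, hY]; noncomm_ring
  zero_mem' := by change _ = _; simp
  smul_mem' := by
    intro c X (hX : _ = _)
    change _ = _
    rw [smul_mul_assoc, hX, mul_smul_comm, smul_neg]

/-- The skew-symmetric antilinear endomorphisms: the tangent space of the orthogonal twistor space
at `J₀`. -/
def skewAntilinearMatrices (m : ℕ) : Submodule ℝ (RMat m) where
  carrier := {X | X ∈ antilinearMatrices m ∧ Xᵀ = -X}
  add_mem' := fun {X Y} hX hY => ⟨add_mem hX.1 hY.1, by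
    rw [Matrix.transpose_add, hX.2, hY.2, neg_add]⟩
  zero_mem' := ⟨zero_mem _, by simp⟩
  smul_mem' := fun c X hX => ⟨Submodule.smul_mem _ c hX.1, by
    rw [Matrix.transpose_smul, hX.2, smul_neg]⟩

theorem std_mul_mem_antilinearMatrices {X : RMat m} (hX : X ∈ antilinearMatrices m) :
    stdComplexStructure m * X ∈ antilinearMatrices m := by
  have h : X * stdComplexStructure m = -(stdComplexStructure m * X) := hX
  change _ = _
  rw [mul_assoc, h, mul_neg]

theorem std_mul_mem_skewAntilinearMatrices {X : RMat m} (hX : X ∈ skewAntilinearMatrices m) :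
    stdComplexStructure m * X ∈ skewAntilinearMatrices m := by
  have h : X * stdComplexStructure m = -(stdComplexStructure m * X) := hX.1
  refine ⟨std_mul_mem_antilinearMatrices hX.1, ?_⟩
  rw [Matrix.transpose_mul, hX.2, transpose_eq_neg_of_mem_orthTwistorSpace
    stdComplexStructure_mem_orthTwistorSpace, neg_mul_neg, h]

/-- A set of complex structures that corresponds to a complex subspace `W` under the Cayley
transform, and on which a group of linear maps acts transitively by conjugation, is a complex
manifold. -/
theorem exists_isComplexManifold {W : Submodule ℝ (RMat m)}
    (hW : ∀ X ∈ W, X * stdComplexStructure m = -(stdComplexStructure m * X))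
    (hJW : ∀ X ∈ W, stdComplexStructure m * X ∈ W) {N : Set (RMat m)}
    (hsq : ∀ A ∈ N, A * A = -1)
    (h1 : ∀ X ∈ W, IsUnit (1 + X) → cayley m X ∈ N)
    (h2 : ∀ B ∈ N, IsUnit (1 - stdComplexStructure m * B) → cayleyInv m B ∈ W)
    (htrans : ∀ A ∈ N, ∃ g : RMat m, IsUnit g ∧ g * stdComplexStructure m = A * g ∧
      ∀ B, g * B * g⁻¹ ∈ N ↔ B ∈ N) :
    ∃ d, IsComplexManifold d N (twistorJ m) := by
  obtain ⟨d, L, hL⟩ := exists_complex_coordinates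
    ((LinearMap.mulLeft ℝ (stdComplexStructure m)).restrict hJW) (fun w => by
      refine Subtype.ext ?_
      change stdComplexStructure m * (stdComplexStructure m * (w : RMat m)) = -w
      rw [← mul_assoc, stdComplexStructure_mul_self, neg_one_mul])
  refine ⟨d, isComplexManifold_of_parametrizations (fun A hA X => ?_) fun A hA => ?_⟩
  · change A * (A * X) = -X
    rw [← mul_assoc, hsq A hA, neg_one_mul]
  · obtain ⟨g, hgu, hgA, hgN⟩ := htrans A hA
    have hA' : g * stdComplexStructure m * g⁻¹ = A := by
      rw [hgA, mul_assoc, mul_inv_of_isUnit hgu, mul_one]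
    rw [← hA']
    exact exists_holomorphicParametrization hW L (fun u => congrArg Subtype.val (hL u)) hgu hsq
      hgN h1 h2

theorem exists_isComplexManifold_twistorSpace (m : ℕ) :
    ∃ d, IsComplexManifold d (twistorSpace m) (twistorJ m) := by
  refine exists_isComplexManifold (W := antilinearMatrices m) (fun _ hX => hX)
    (fun _ => std_mul_mem_antilinearMatrices) (fun _ hA => hA) (fun X _ hu => cayley_mul_self hu)
    (fun B hB hu => cayleyInv_mul_std hB hu) fun A hA => ?_
  obtain ⟨g, hgu, hgA⟩ := exists_isUnit_mul_std_eq hA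
  refine ⟨g, hgu, hgA, fun B => ?_⟩
  change g * B * g⁻¹ * (g * B * g⁻¹) = -1 ↔ B * B = -1
  have h : g * B * g⁻¹ * (g * B * g⁻¹) * g = g * (B * B) := by
    calc _ = g * B * (g⁻¹ * g) * B * (g⁻¹ * g) := by simp only [mul_assoc]
      _ = _ := by rw [inv_mul_of_isUnit hgu]; simp only [mul_assoc, mul_one]
  rw [← hgu.mul_left_inj, h, neg_one_mul, ← mul_neg_one g, hgu.mul_right_inj]

theorem exists_isComplexManifold_orthTwistorSpace (m : ℕ) :
    ∃ d, IsComplexManifold d (orthTwistorSpace m) (twistorJ m) := by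
  refine exists_isComplexManifold (W := skewAntilinearMatrices m) (fun _ hX => hX.1)
    (fun _ => std_mul_mem_skewAntilinearMatrices) (fun _ hA => hA.1)
    (fun X hX hu => mem_orthTwistorSpace_iff.2
      ⟨cayley_mul_self hu, transpose_cayley hX.1 hX.2 hu⟩)
    (fun B hB hu => ⟨cayleyInv_mul_std hB.1 hu, transpose_cayleyInv hB hu⟩) fun A hA => ?_
  obtain ⟨g, hg, hgA⟩ := exists_orthogonal_mul_std_eq hA
  have h1 : g * gᵀ = 1 := (Matrix.mem_orthogonalGroup_iff _ ℝ).1 hg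
  have h2 : gᵀ * g = 1 := (Matrix.mem_orthogonalGroup_iff' _ ℝ).1 hg
  have hgu : IsUnit g := ⟨⟨g, gᵀ, h1, h2⟩, rfl⟩
  refine ⟨g, hgu, hgA, fun B => ?_⟩
  rw [Matrix.inv_eq_left_inv h2, mem_orthTwistorSpace_iff, mem_orthTwistorSpace_iff]
  have hu' : IsUnit gᵀ := (Matrix.isUnit_transpose g).2 hgu
  have e1 : g * B * gᵀ * (g * B * gᵀ) = g * (B * B) * gᵀ := by
    calc _ = g * B * (gᵀ * g) * B * gᵀ := by simp only [mul_assoc]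
      _ = _ := by rw [h2]; simp only [mul_assoc, mul_one]
  have e2 : (g * B * gᵀ)ᵀ = g * Bᵀ * gᵀ := by
    rw [Matrix.transpose_mul, Matrix.transpose_mul, Matrix.transpose_transpose, mul_assoc]
  have e3 : (-1 : RMat m) = g * (-1) * gᵀ := by rw [mul_neg_one, neg_mul, h1]
  have e4 : -(g * B * gᵀ) = g * (-B) * gᵀ := by noncomm_ring
  rw [e1, e2, e4]
  nth_rewrite 1 [e3]
  rw [hu'.mul_left_inj, hgu.mul_right_inj, hu'.mul_left_inj, hgu.mul_right_inj]

end ComplexManifolds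

/-! ### The metric and the tangent spaces -/

section Metric

variable {m : ℕ}

/-- The trace as a continuous linear form. -/
noncomputable def traceCLM (m : ℕ) : RMat m →L[ℝ] ℝ :=
  LinearMap.toContinuousLinearMap (Matrix.traceLinearMap _ ℝ ℝ)

/-- The transposition as a continuous linear map. -/
noncomputable def transposeCLM (m : ℕ) : RMat m →L[ℝ] RMat m :=
  LinearMap.toContinuousLinearMap (Matrix.transposeLinearEquiv _ _ ℝ ℝ).toLinearMap

theorem twistorMetric_apply_of_sq {A : RMat m} (hA : A * A = -1) (X Y : RMat m) :
    twistorMetric m A X Y = 1 / 4 * ((X * Yᵀ).trace + ((A * X * A) * (A * Y * A)ᵀ).trace +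
      ((A * X) * (A * Y)ᵀ).trace + ((X * A) * (Y * A)ᵀ).trace) := by
  have hinv : A⁻¹ = -A := Matrix.inv_eq_left_inv (by rw [neg_mul, hA, neg_neg])
  have h (Z : RMat m) : A * (A * Z) = -Z := by rw [← mul_assoc, hA, neg_one_mul]
  simp only [twistorMetric, glInner, twistorJ, LinearMap.add_apply, LinearMap.smul_apply,
    LinearMap.compl₁₂_apply, LinearMap.mk₂_apply, LinearMap.mulLeft_apply, hinv, smul_eq_mul,
    mul_neg, neg_mul, h, Matrix.transpose_neg, neg_neg]
  ring

theorem trace_mul_transpose_comm (X Y : RMat m) : (X * Yᵀ).trace = (Y * Xᵀ).trace := by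
  rw [← Matrix.trace_transpose, Matrix.transpose_mul, Matrix.transpose_transpose]

theorem trace_mul_transpose_self_nonneg (X : RMat m) : 0 ≤ (X * Xᵀ).trace :=
  (Matrix.posSemidef_self_mul_conjTranspose X).trace_nonneg

theorem trace_mul_transpose_self_pos {X : RMat m} (hX : X ≠ 0) : 0 < (X * Xᵀ).trace :=
  (trace_mul_transpose_self_nonneg X).lt_of_ne' fun h =>
    hX (Matrix.trace_mul_conjTranspose_self_eq_zero_iff.1 h)

theorem isHermitianManifold_of_isComplexManifold {d : ℕ} {N : Set (RMat m)}
    (hN : IsComplexManifold d N (twistorJ m)) (hsq : ∀ A ∈ N, A * A = -1) :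
    IsHermitianManifold d N (twistorJ m) (twistorMetric m) where
  toIsComplexManifold := hN
  metric_symm := by
    intro A hA X _ Y _
    rw [twistorMetric_apply_of_sq (hsq A hA), twistorMetric_apply_of_sq (hsq A hA),
      trace_mul_transpose_comm X, trace_mul_transpose_comm (A * X * A),
      trace_mul_transpose_comm (A * X), trace_mul_transpose_comm (X * A)]
  metric_pos := by
    intro A hA X _ hX
    rw [twistorMetric_apply_of_sq (hsq A hA)]
    linarith [trace_mul_transpose_self_pos hX, trace_mul_transpose_self_nonneg (A * X * A),
      trace_mul_transpose_self_nonneg (A * X), trace_mul_transpose_self_nonneg (X * A)]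
  metric_smooth := by
    intro V ψ hψ u w
    have hd : ∀ u, ContDiffOn ℝ ∞ (fun z => fderiv ℝ ψ z u) V := fun u =>
      (hψ.smooth.fderiv_of_isOpen hψ.isOpen (by simp)).clm_apply contDiffOn_const
    have htr : ∀ f h : ComplexModel d → RMat m, ContDiffOn ℝ ∞ f V → ContDiffOn ℝ ∞ h V →
        ContDiffOn ℝ ∞ (fun z => (f z * (h z)ᵀ).trace) V := fun f h hf hh =>
      (traceCLM m).contDiff.comp_contDiffOn
        (hf.mul ((transposeCLM m).contDiff.comp_contDiffOn hh))
    have hs := hψ.smooth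
    refine ContDiffOn.congr ?_ fun z hz => twistorMetric_apply_of_sq (hsq _ (hψ.mem hz)) _ _
    exact contDiffOn_const.mul ((((htr _ _ (hd u) (hd w)).add
      (htr _ _ ((hs.mul (hd u)).mul hs) ((hs.mul (hd w)).mul hs))).add
      (htr _ _ (hs.mul (hd u)) (hs.mul (hd w)))).add (htr _ _ ((hd u).mul hs) ((hd w).mul hs)))
  metric_J := by
    intro A hA X _ Y _
    have h (Z : RMat m) : A * (A * Z) = -Z := by rw [← mul_assoc, hsq A hA, neg_one_mul]
    rw [twistorMetric_apply_of_sq (hsq A hA), twistorMetric_apply_of_sq (hsq A hA)]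
    simp only [twistorJ, LinearMap.mulLeft_apply, h, neg_mul, mul_neg, Matrix.transpose_neg,
      neg_neg]
    ring

theorem mul_eq_neg_of_mem_tangentVectors {N : Set (RMat m)} (hsq : ∀ A ∈ N, A * A = -1)
    {A X : RMat m} (hX : X ∈ tangentVectors N A) : X * A = -(A * X) := by
  obtain ⟨γ, -, rfl, hγN, hγX⟩ := hX
  have h1 : HasDerivAt (fun t => γ t * γ t) (X * γ 0 + γ 0 * X) 0 := hγX.mul hγX
  have h2 : (fun t => γ t * γ t) =ᶠ[nhds 0] fun _ => -1 := by
    filter_upwards [hγN] with t ht using hsq _ ht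
  exact eq_neg_of_add_eq_zero_left
    (h1.unique ((hasDerivAt_const (0 : ℝ) (-1 : RMat m)).congr_of_eventuallyEq h2))

theorem transpose_eq_neg_of_mem_tangentVectors {A X : RMat m}
    (hX : X ∈ tangentVectors (orthTwistorSpace m) A) : Xᵀ = -X := by
  obtain ⟨γ, -, rfl, hγN, hγX⟩ := hX
  have h1 : HasDerivAt (fun t => (γ t)ᵀ) Xᵀ 0 :=
    (transposeCLM m).hasFDerivAt.comp_hasDerivAt (0 : ℝ) hγX
  have h2 : (fun t => (γ t)ᵀ) =ᶠ[nhds 0] fun t => -γ t := by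
    filter_upwards [hγN] with t ht using transpose_eq_neg_of_mem_orthTwistorSpace ht
  exact h1.unique (hγX.fun_neg.congr_of_eventuallyEq h2)

end Metric

/-! ### The fundamental form -/

section FundamentalForm

variable {m : ℕ}

theorem twistorMetric_mul_left {A X Y : RMat m} (hA : A ∈ orthTwistorSpace m)
    (hX : X ∈ tangentVectors (orthTwistorSpace m) A)
    (hY : Y ∈ tangentVectors (orthTwistorSpace m) A) :
    twistorMetric m A (A * X) Y = -(A * X * Y).trace := by
  have hsq : A * A = -1 := hA.1
  have hAt := transpose_eq_neg_of_mem_orthTwistorSpace hA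
  have hXA : X * A = -(A * X) := mul_eq_neg_of_mem_tangentVectors (fun _ h => h.1) hX
  have hYA : Y * A = -(A * Y) := mul_eq_neg_of_mem_tangentVectors (fun _ h => h.1) hY
  have hYt := transpose_eq_neg_of_mem_tangentVectors hY
  have h (Z : RMat m) : A * (A * Z) = -Z := by rw [← mul_assoc, hsq, neg_one_mul]
  have e1 : A * (A * X) * A = A * X := by rw [h, neg_mul, hXA, neg_neg]
  have e2 : (A * Y * A)ᵀ = -Y := by
    rw [mul_assoc, hYA, mul_neg, h, neg_neg, hYt]
  have e3 : (A * Y)ᵀ = Y * A := by rw [Matrix.transpose_mul, hAt, hYt, neg_mul_neg]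
  have e4 : (Y * A)ᵀ = A * Y := by rw [Matrix.transpose_mul, hAt, hYt, neg_mul_neg]
  have e5 : A * X * A * (A * Y) = -(A * X * Y) := by
    rw [mul_assoc (A * X), h, mul_neg]
  have e6 : (X * (Y * A)).trace = (A * X * Y).trace := by
    rw [← mul_assoc, Matrix.trace_mul_comm, mul_assoc]
  rw [twistorMetric_apply_of_sq hsq, e1, e2, e3, e4, e5, h, hYt]
  simp only [mul_neg, neg_mul, Matrix.trace_neg, e6]
  ring

/-- A product of three matrices that anticommute with a complex structure anticommutes with it as
well, so it is conjugate to its negative. -/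
theorem trace_mul_mul_eq_zero {A X Y Z : RMat m} (hA : A * A = -1) (hX : X * A = -(A * X))
    (hY : Y * A = -(A * Y)) (hZ : Z * A = -(A * Z)) : (X * Y * Z).trace = 0 := by
  have h1 : X * Y * Z * A = -(A * (X * Y * Z)) := by
    rw [mul_assoc _ Z, hZ, mul_neg, ← mul_assoc, mul_assoc X, hY, mul_neg, ← mul_assoc, hX]
    noncomm_ring
  have h2 : (X * Y * Z * A * A).trace = -(X * Y * Z * A * A).trace := by
    conv_lhs => rw [h1, neg_mul, Matrix.trace_neg, mul_assoc, Matrix.trace_mul_comm]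
  have h3 : (X * Y * Z * A * A).trace = -(X * Y * Z).trace := by
    rw [mul_assoc _ A A, hA, mul_neg_one, Matrix.trace_neg]
  linarith

/-- On the tangent spaces of the orthogonal twistor space the fundamental form is
`-tr(A X Y) = -½ tr(A (X Y - Y X))`, which is linear in `A`. -/
theorem isKahlerManifold_orthTwistorSpace {d : ℕ}
    (h : IsComplexManifold d (orthTwistorSpace m) (twistorJ m)) :
    IsKahlerManifold d (orthTwistorSpace m) (twistorJ m) (twistorMetric m) where
  toIsHermitianManifold := isHermitianManifold_of_isComplexManifold h fun _ hA => hA.1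
  closed := by
    intro V ψ hψ
    have hanti : ∀ {A X : RMat m}, X ∈ tangentVectors (orthTwistorSpace m) A →
        X * A = -(A * X) := fun hX => mul_eq_neg_of_mem_tangentVectors (fun _ h => h.1) hX
    refine hψ.exists_closed_form (tripleForm ((-1 / 2 : ℝ) • traceCLM m))
      (fun A X Y => twistorMetric m A (twistorJ m A X) Y) ?_ ?_
    · intro A hA X hX Y hY
      have hYX : (A * Y * X).trace = -(A * X * Y).trace := by
        rw [Matrix.trace_mul_comm, ← mul_assoc, hanti hX, neg_mul, Matrix.trace_neg]
      refine Eq.trans ?_ (twistorMetric_mul_left hA hX hY).symm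
      change (-1 / 2 : ℝ) * (A * X * Y).trace - (-1 / 2 : ℝ) * (A * Y * X).trace = _
      rw [hYX]
      ring
    · intro A hA X hX Y hY Z hZ
      change (-1 / 2 : ℝ) * (X * Y * Z).trace = 0
      rw [trace_mul_mul_eq_zero hA.1 (hanti hX) (hanti hY) (hanti hZ), mul_zero]

end FundamentalForm

/-- The orthogonal twistor space of `S^(2n)` coincides with that of `ℝ^(2n+2)`, which is
`O(2n+2)/U(n+1)` through `g ↦ g J₀ g⁻¹`, and it is a Kähler submanifold of the twistor space
of `ℝ^(2n+2)` with complex structure `J̃` and metric `ds²`. -/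
theorem theorem3p1 (n : ℕ) :
    sphereOrthTwistorSpace n = orthTwistorSpace (n + 1) ∧
    (∃ Φ : (Matrix.orthogonalGroup (Fin (2 * (n + 1))) ℝ ⧸ unitaryStabilizer (n + 1)) ≃ₜ
        orthTwistorSpace (n + 1),
      ∀ h : Matrix.orthogonalGroup (Fin (2 * (n + 1))) ℝ,
        (Φ (QuotientGroup.mk h) : RMat (n + 1)) =
          (h : RMat (n + 1)) * stdComplexStructure (n + 1) * (h : RMat (n + 1))⁻¹) ∧
    IsKahlerSubmanifold (sphereOrthTwistorSpace n) (twistorSpace (n + 1))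
      (twistorJ (n + 1)) (twistorMetric (n + 1)) := by
  refine ⟨sphereOrthTwistorSpace_eq n, exists_homeomorph_orthTwistorSpace (n + 1), ?_⟩
  rw [sphereOrthTwistorSpace_eq]
  obtain ⟨d, hd⟩ := exists_isComplexManifold_twistorSpace (n + 1)
  obtain ⟨e, he⟩ := exists_isComplexManifold_orthTwistorSpace (n + 1)
  exact ⟨⟨d, isHermitianManifold_of_isComplexManifold hd fun _ hA => hA⟩, fun _ hA => hA.1,
    fun A hA => he.image_tangentVectors hA, e, isKahlerManifold_orthTwistorSpace he⟩
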